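/- **Notation.** Let $\overline{\mathbb Q}$ be the algebraic closure of $\mathbb Q$ in $\mathbb C$, $\mathbb Q^{\rm ab}\subset\overline{\mathbb Q}$ the maximal abelian extension of $\mathbb Q$, $\mu_\infty\subset\mathbb C^\times$ the group of all roots of unity, $\hat{\mathbb Z}=\prod_p\mathbb Z_p$, and $\mathbb A=\mathbb A^{\rm f}\times\mathbb R$ the adèle ring of $\mathbb Q$ with its finite part $\mathbb A^{\rm f}$. Let $\mathbb N$ be the multiplicative monoid of positive integers, and $\mathbb Q_+$, $\mathbb R_+$ the multiplicative groups of positive rational and positive real numbers. *Rational Witt vectors.* For a commutative ring $R$, $W_{\rm rat}(R)$ is the group of fractions $f/g$ of polynomials $f,g\in R[t]$ with $f(0)=g(0)=1$. Its addition is the multiplication of fractions, its multiplication is the functorial biadditive operation with $(1-at)\odot(1-bt)=1-abt$. Put $[a]=1-at$ for $a\in R$, and for $n\in\mathbb N$ let $F_n$ be the functorial Frobenius endomorphism of the ring $W_{\rm rat}(R)$ with $F_n[a]=[a^n]$. *Deninger systems.* For a field $K\subset\overline{\mathbb Q}$ with ring of integers $\mathcal O_K$ put $$\dot X_K=\{(\mathfrak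 p,P)\mid \mathfrak p\in{\rm Spec}\,\mathcal O_K,\ P:W_{\rm rat}(\kappa(\mathfrak p))\to\mathbb C\ \text{a ring homomorphism}\},\qquad F_n(\mathfrak p,P)=(\mathfrak p,P\circ F_n).$$ For $K\subset L\subset\overline{\mathbb Q}$ there is the projection $\dot X_L\to\dot X_K$, $(\mathfrak P,P)\mapsto(\mathfrak P\cap K,P|_{W_{\rm rat}(\kappa(\mathfrak P\cap K))})$. The space $\dot X_{\overline{\mathbb Q}}$ has the topology of pointwise convergence of the multiplicative maps $\mathcal O_{\overline{\mathbb Q}}\to\mathbb C$, $a\mapsto P([a\bmod\mathfrak p])$, and $\dot X_K$ has the quotient topology with respect to $\dot X_{\overline{\mathbb Q}}\to\dot X_K$. Let $\check X_K=\varinjlim_{n\in\mathbb N}\dot X_K$ be the inductive limit over $\mathbb N$ ordered by divisibility, with transition maps $F_{m/n}$ for $n\mid m$ and with the inductive limit topology; on it the $F_n$ become invertible, so that $\mathbb Q_+$ acts. Let $\mathfrak X_K=\check X_K\times_{\mathbb Q_+}\mathbb R_+$ be the quotient of $\check X_K\times\mathbb R_+$ by the action $q\cdot(x,u)=(F_qx,q^{-1}u)$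 of $\mathbb Q_+$, with the quotient topology. It carries the flow $\phi^t[x,u]=[x,tu]$ $(t\in\mathbb R_+)$, the right action of ${\rm Gal}(K/\mathbb Q)$ (for $K/\mathbb Q$ Galois) induced by $(\mathfrak p,P)^\sigma=(\sigma^{-1}\mathfrak p,P\circ\sigma)$, and for $K\subset L$ the induced projection $\varpi_{L/K}:\mathfrak X_L\to\mathfrak X_K$. *Connes–Consani adelic spaces.* Let ${\rm cycl}:{\rm Gal}(\mathbb Q^{\rm ab}/\mathbb Q)\to\hat{\mathbb Z}^\times$ be the cyclotomic character, $\sigma(\zeta)=\zeta^{{\rm cycl}(\sigma)}$ for $\zeta\in\mu_\infty$. For a subextension $F$ of $\mathbb Q^{\rm ab}/\mathbb Q$ put $U_F={\rm cycl}({\rm Gal}(\mathbb Q^{\rm ab}/F))$ and $$\mathscr X_F=\mathbb Q^\times\backslash\mathbb A/U_F,\qquad\text{in particular}\quad \mathscr X_{\mathbb Q^{\rm ab}}=\mathbb Q^\times\backslash\mathbb A,$$ with the quotient topology, where $U_F\subset\hat{\mathbb Z}^\times$ acts by multiplication on the finite components. The group $\mathbb R_+$ acts on $\mathscr X_F$ by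 multiplication on the real component, and $g\in{\rm Gal}(F/\mathbb Q)$ acts by multiplication of the finite components by ${\rm cycl}(\tilde g)$, for any extension $\tilde g$ of $g$ to $\mathbb Q^{\rm ab}$. Let $\varphi_{\mathbb Q^{\rm ab}/F}:\mathscr X_{\mathbb Q^{\rm ab}}\to\mathscr X_F$ be the natural map. *The map $\Psi_{\mathbb Q^{\rm ab}}$.* Identify $\hat{\mathbb Z}$ with ${\rm Hom}(\mu_\infty,\mu_\infty)$ by $a\mapsto(\zeta\mapsto\zeta^a)$. Define $\psi:\dot X_{\mathbb Q^{\rm ab}}\to\hat{\mathbb Z}$ by sending $(\mathfrak P,P)$ to the character $\zeta\mapsto P([\zeta\bmod\mathfrak P])$ of $\mu_\infty$, i.e. to $P|_{\mu_\infty(\kappa(\mathfrak P))}\circ\iota_{\mathfrak P}$ with $\iota_{\mathfrak P}$ the reduction of roots of unity modulo $\mathfrak P$. Let $\check\psi:\check X_{\mathbb Q^{\rm ab}}\to\mathbb A^{\rm f}$ be its extension, $\check\psi(F_n^{-1}x)=n^{-1}\psi(x)$. Let $\mathbb A^{\rm f}\times_{\mathbb Q_+}\mathbb R_+$ be the quotient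 of $\mathbb A^{\rm f}\times\mathbb R_+$ by $q\cdot(a,u)=(qa,q^{-1}u)$, and $\tau:\mathbb A^{\rm f}\times_{\mathbb Q_+}\mathbb R_+\to\mathbb Q^\times\backslash\mathbb A$, $\tau[a,u]=[(a,u^{-1})]$. Then $$\Psi_{\mathbb Q^{\rm ab}}=\tau\circ(\check\psi\times_{\mathbb Q_+}{\rm id}_{\mathbb R_+}):\mathfrak X_{\mathbb Q^{\rm ab}}\to\mathscr X_{\mathbb Q^{\rm ab}},\qquad \Psi_{\mathbb Q^{\rm ab}}[x,u]=[(\check\psi(x),u^{-1})].$$ **Lemma 3.5.** The map $\Psi_{\mathbb Q^{\rm ab}}:\mathfrak X_{\mathbb Q^{\rm ab}}\to\mathscr X_{\mathbb Q^{\rm ab}}$ is continuous. It is $\mathbb R_+$-anti-equivariant, $\Psi_{\mathbb Q^{\rm ab}}(\phi^t x)=t^{-1}\cdot\Psi_{\mathbb Q^{\rm ab}}(x)$ for all $t\in\mathbb R_+$, and ${\rm Gal}(\mathbb Q^{\rm ab}/\mathbb Q)$-equivariant, $\Psi_{\mathbb Q^{\rm ab}}(x^\sigma)=\Psi_{\mathbb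 Q^{\rm ab}}(x)^\sigma$ for all $\sigma\in{\rm Gal}(\mathbb Q^{\rm ab}/\mathbb Q)$. For every subextension $F$ of $\mathbb Q^{\rm ab}/\mathbb Q$ of finite degree over $\mathbb Q$ there is a unique map $\Psi_F:\mathfrak X_F\to\mathscr X_F$ with $$\Psi_F\circ\varpi_{\mathbb Q^{\rm ab}/F}=\varphi_{\mathbb Q^{\rm ab}/F}\circ\Psi_{\mathbb Q^{\rm ab}},$$ and $\Psi_F$ is continuous, $\mathbb R_+$-anti-equivariant and ${\rm Gal}(F/\mathbb Q)$-equivariant. -/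

import Mathlib

open Polynomial

namespace RatWitt

/-- `∏ g(a)` over the "inverse roots" `a` of `p = ∏ (1 - a t)`, written as a resultant:
`g` is a polynomial in a variable `x` with coefficients in `R[t]`, and `p.reverse = ∏ (x - a)`. -/
noncomputable def rootProd {R : Type*} [CommRing R] (p : R[X]) (g : R[X][X]) : R[X] :=
  resultant (p.reverse.map C) g p.natDegree g.natDegree

lemma rootProd_eq {R : Type*} [CommRing R] (p : R[X]) (g : R[X][X]) (hp : p.coeff 0 = 1)
    (hg : g.coeff 0 = 1) (m n : ℕ) (hm : p.natDegree ≤ m) (hn : g.natDegree ≤ n) :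
    rootProd p g = resultant ((p.reflect m).map C) g m n := by
  nontriviality R
  have key : ∀ k, resultant ((p.reflect (p.natDegree + k)).map C) g (p.natDegree + k) g.natDegree
      = rootProd p g := by
    intro k
    induction k with
    | zero => rfl
    | succ k ih =>
      have h1 : p.reflect (p.natDegree + (k + 1)) = X * p.reflect (p.natDegree + k) := by
        have := reflect_mul (1 : R[X]) p (F := 1) (G := p.natDegree + k) (by simp) (by simp)
        rw [one_mul, reflect_one, pow_one] at this
        rw [← this]; congr 1; ring
      have hd : (p.reflect (p.natDegree + k)).natDegree = p.natDegree + k := by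
        apply natDegree_eq_of_le_of_coeff_ne_zero
        · rw [natDegree_le_iff_coeff_eq_zero]
          intro N hN
          rw [coeff_reflect, revAt_eq_self_of_lt hN]
          exact coeff_eq_zero_of_natDegree_lt (by omega)
        · rw [coeff_reflect, revAt_le le_rfl, Nat.sub_self, hp]; exact one_ne_zero
      have hd' : ((p.reflect (p.natDegree + k)).map (C : R →+* R[X])).natDegree
          = p.natDegree + k := by
        rw [natDegree_map_eq_of_injective C_injective, hd]
      have := resultant_mul_left (X : R[X][X]) ((p.reflect (p.natDegree + k)).map C) g
        g.natDegree le_rfl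
      rw [hd', natDegree_X, ih] at this
      rw [h1, Polynomial.map_mul, map_X, show p.natDegree + (k + 1) = 1 + (p.natDegree + k) by ring,
        this]
      have hX := resultant_X_sub_C_left g g.natDegree 0 le_rfl
      rw [C_0, sub_zero] at hX
      rw [hX, ← coeff_zero_eq_eval_zero, hg, one_mul]
  obtain ⟨k, rfl⟩ := Nat.exists_eq_add_of_le hm
  obtain ⟨l, rfl⟩ := Nat.exists_eq_add_of_le hn
  rw [resultant_add_right_deg _ _ _ _ _ le_rfl, key, coeff_map, coeff_reflect, revAt_le le_rfl,
    Nat.sub_self, hp]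
  simp

lemma rootProd_map {R S : Type*} [CommRing R] [CommRing S] (f : R →+* S) (p : R[X]) (g : R[X][X])
    (hp : p.coeff 0 = 1) (hg : g.coeff 0 = 1) :
    rootProd (p.map f) (g.map (mapRingHom f)) = (rootProd p g).map f := by
  rw [rootProd_eq (p.map f) (g.map (mapRingHom f)) (by simp [hp]) (by simp [hg]) p.natDegree
    g.natDegree natDegree_map_le natDegree_map_le, rootProd, ← coe_mapRingHom (f := f),
    ← resultant_map_map, reverse, coe_mapRingHom, reflect_map, Polynomial.map_map, Polynomial.map_map]
  congr 2
  ext x : 1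
  simp

lemma rootProd_one {R : Type*} [CommRing R] (g : R[X][X]) : rootProd (1 : R[X]) g = 1 := by
  rw [rootProd]; simp

lemma rootProd_mul_left {R : Type*} [CommRing R] (p q : R[X]) (g : R[X][X]) (hp : p.coeff 0 = 1)
    (hq : q.coeff 0 = 1) (hg : g.coeff 0 = 1) :
    rootProd (p * q) g = rootProd p g * rootProd q g := by
  nontriviality R
  have hd : ∀ p : R[X], p.coeff 0 = 1 → (p.reverse.map (C : R →+* R[X])).natDegree
      = p.natDegree := by
    intro p hp
    rw [natDegree_map_eq_of_injective C_injective, reverse_natDegree,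
      natTrailingDegree_eq_zero_of_constantCoeff_ne_zero (by simp [constantCoeff_apply, hp]),
      Nat.sub_zero]
  have hpq : (p * q).coeff 0 = 1 := by rw [mul_coeff_zero, hp, hq, mul_one]
  rw [rootProd_eq (p * q) g hpq hg (p.natDegree + q.natDegree) g.natDegree natDegree_mul_le le_rfl,
    reflect_mul p q le_rfl le_rfl, Polynomial.map_mul]
  have := resultant_mul_left (p.reverse.map C) (q.reverse.map C) g g.natDegree le_rfl
  rw [hd p hp, hd q hq] at this
  exact this

lemma rootProd_mul_right {R : Type*} [CommRing R] (p : R[X]) (g h : R[X][X]) (hp : p.coeff 0 = 1)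
    (hg : g.coeff 0 = 1) (hh : h.coeff 0 = 1) :
    rootProd p (g * h) = rootProd p g * rootProd p h := by
  have hpd : (p.reverse.map (C : R →+* R[X])).natDegree ≤ p.natDegree :=
    natDegree_map_le.trans (reverse_natDegree_le p)
  rw [rootProd_eq p (g * h) hp (by rw [mul_coeff_zero, hg, hh, mul_one]) p.natDegree
    (g.natDegree + h.natDegree) le_rfl natDegree_mul_le]
  exact resultant_mul_right _ g h _ hpd

lemma rootProd_linear {R : Type*} [CommRing R] (a : R) (g : R[X][X]) (hg : g.coeff 0 = 1) :
    rootProd (1 - C a * X) g = g.eval (C a) := by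
  rw [rootProd_eq _ g (by simp) hg 1 g.natDegree _ le_rfl]
  · have : reflect 1 (1 - C a * X : R[X]) = X - C a := by
      rw [reflect_sub, reflect_one, reflect_C_mul, reflect_one_X, pow_one, mul_one]
    rw [this, Polynomial.map_sub, map_X, map_C]
    exact resultant_X_sub_C_left _ _ _ le_rfl
  · refine (natDegree_sub_le _ _).trans ?_
    rw [natDegree_one]
    exact max_le (Nat.zero_le _) ((natDegree_C_mul_le _ _).trans natDegree_X_le)

lemma rootProd_coeff_zero {R : Type*} [CommRing R] (p : R[X]) (g : R[X][X]) (hp : p.coeff 0 = 1)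
    (hg : g.map constantCoeff = 1) : (rootProd p g).coeff 0 = 1 := by
  have h : constantCoeff (rootProd p g) = 1 := by
    rw [rootProd, ← resultant_map_map, hg, resultant_one_right, coeff_map, coeff_map]
    nontriviality R
    rw [reverse, coeff_reflect, revAt_le le_rfl, Nat.sub_self, hp]
    simp
  exact h

/-- The product of `p = ∏ (1 - a t)` and `q = ∏ (1 - b t)`: `p ⊙ q = ∏ q(a t) = ∏ (1 - a b t)`. -/
noncomputable def wmul {R : Type*} [CommRing R] (p q : R[X]) : R[X] :=
  rootProd p ((q.map C).comp (C X * X))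

/-- The `n`-th Frobenius of `p = ∏ (1 - a t)`: `F_n p = ∏ (1 - a ^ n t)`. -/
noncomputable def wfrob {R : Type*} [CommRing R] (n : ℕ+) (p : R[X]) : R[X] :=
  rootProd p (1 - C X * X ^ (n : ℕ))

lemma scale_coeff_zero {R : Type*} [CommRing R] (q : R[X]) (hq : q.coeff 0 = 1) :
    ((q.map (C : R →+* R[X])).comp (C X * X)).coeff 0 = 1 := by
  rw [comp_C_mul_X_coeff]; simp [hq]

lemma frobPoly_coeff_zero {R : Type*} [CommRing R] (n : ℕ+) :
    (1 - C X * X ^ (n : ℕ) : R[X][X]).coeff 0 = 1 := by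
  simp [n.ne_zero.symm]

lemma wmul_coeff_zero {R : Type*} [CommRing R] (p q : R[X]) (hp : p.coeff 0 = 1)
    (hq : q.coeff 0 = 1) : (wmul p q).coeff 0 = 1 := by
  refine rootProd_coeff_zero p _ hp ?_
  rw [Polynomial.map_comp, Polynomial.map_map]
  simp only [Polynomial.map_mul, map_C, map_X]
  have : (constantCoeff (X : R[X])) = 0 := by simp
  rw [this, C_0, zero_mul, comp_zero, ← coeff_zero_eq_eval_zero, coeff_map, hq]
  simp

lemma wfrob_coeff_zero {R : Type*} [CommRing R] (n : ℕ+) (p : R[X]) (hp : p.coeff 0 = 1) :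
    (wfrob n p).coeff 0 = 1 := by
  refine rootProd_coeff_zero p _ hp ?_
  simp

lemma wmul_map {R S : Type*} [CommRing R] [CommRing S] (f : R →+* S) (p q : R[X])
    (hp : p.coeff 0 = 1) (hq : q.coeff 0 = 1) :
    wmul (p.map f) (q.map f) = (wmul p q).map f := by
  rw [wmul, wmul, ← rootProd_map f p _ hp (scale_coeff_zero q hq)]
  refine congrArg (rootProd (p.map f)) ?_
  rw [Polynomial.map_comp, Polynomial.map_map, Polynomial.map_map]
  congr 1
  · congr 1; ext x; simp
  · simp

lemma wfrob_map {R S : Type*} [CommRing R] [CommRing S] (f : R →+* S) (n : ℕ+) (p : R[X])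
    (hp : p.coeff 0 = 1) : wfrob n (p.map f) = (wfrob n p).map f := by
  rw [wfrob, wfrob, ← rootProd_map f p _ hp (frobPoly_coeff_zero n)]
  refine congrArg (rootProd (p.map f)) ?_
  simp

lemma wmul_linear {R : Type*} [CommRing R] (a : R) (q : R[X]) (hq : q.coeff 0 = 1) :
    wmul (1 - C a * X) q = q.comp (C a * X) := by
  rw [wmul, rootProd_linear _ _ (scale_coeff_zero q hq), eval_comp, eval_map]
  simp only [eval_mul, eval_C, eval_X, mul_comm X]
  rfl

lemma wfrob_linear {R : Type*} [CommRing R] (n : ℕ+) (a : R) :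
    wfrob n (1 - C a * X) = 1 - C (a ^ (n : ℕ)) * X := by
  rw [wfrob, rootProd_linear _ _ (frobPoly_coeff_zero n)]
  simp only [eval_sub, eval_one, eval_mul, eval_C, eval_pow, eval_X, C_pow]
  rw [mul_comm]

lemma wmul_mul_left {R : Type*} [CommRing R] (p q r : R[X]) (hp : p.coeff 0 = 1)
    (hq : q.coeff 0 = 1) (hr : r.coeff 0 = 1) : wmul (p * q) r = wmul p r * wmul q r :=
  rootProd_mul_left p q _ hp hq (scale_coeff_zero r hr)

lemma wmul_mul_right {R : Type*} [CommRing R] (p q r : R[X]) (hp : p.coeff 0 = 1)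
    (hq : q.coeff 0 = 1) (hr : r.coeff 0 = 1) : wmul p (q * r) = wmul p q * wmul p r := by
  rw [wmul, Polynomial.map_mul, mul_comp]
  exact rootProd_mul_right p _ _ hp (scale_coeff_zero q hq) (scale_coeff_zero r hr)

lemma wfrob_mul {R : Type*} [CommRing R] (n : ℕ+) (p q : R[X]) (hp : p.coeff 0 = 1)
    (hq : q.coeff 0 = 1) : wfrob n (p * q) = wfrob n p * wfrob n q :=
  rootProd_mul_left p q _ hp hq (frobPoly_coeff_zero n)

lemma exists_split {R : Type*} [CommRing R] (p q r : R[X]) (hp : p.coeff 0 = 1)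
    (hq : q.coeff 0 = 1) (hr : r.coeff 0 = 1)
    (P : ∀ {S : Type _} [CommRing S], S[X] → S[X] → S[X] → Prop)
    (closed : ∀ (K : Type _) [Field K] (_ : IsAlgClosed K) (p q r : K[X]), p.coeff 0 = 1 →
      q.coeff 0 = 1 → r.coeff 0 = 1 → P p q r)
    (inj : ∀ (S T : Type _) [CommRing S] [CommRing T] (f : S →+* T), Function.Injective f →
      ∀ p q r : S[X], p.coeff 0 = 1 → q.coeff 0 = 1 → r.coeff 0 = 1 →
        P (p.map f) (q.map f) (r.map f) → P p q r)
    (push : ∀ (S T : Type _) [CommRing S] [CommRing T] (f : S →+* T),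
      ∀ p q r : S[X], p.coeff 0 = 1 → q.coeff 0 = 1 → r.coeff 0 = 1 →
        P p q r → P (p.map f) (q.map f) (r.map f)) : P p q r := by
  let φ : MvPolynomial R ℤ →+* R := MvPolynomial.eval₂Hom (algebraMap ℤ R) id
  have hφ : Function.Surjective φ := fun x ↦ ⟨.X x, by simp [φ]⟩
  have lift : ∀ p : R[X], p.coeff 0 = 1 → ∃ p' : (MvPolynomial R ℤ)[X],
      p'.coeff 0 = 1 ∧ p'.map φ = p := by
    intro p hp
    obtain ⟨p', rfl⟩ := Polynomial.map_surjective φ hφ p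
    refine ⟨p' - C (p'.coeff 0 - 1), by simp, ?_⟩
    rw [coeff_map] at hp
    simp [hp]
  obtain ⟨p', hp', rfl⟩ := lift p hp
  obtain ⟨q', hq', rfl⟩ := lift q hq
  obtain ⟨r', hr', rfl⟩ := lift r hr
  refine push _ _ φ _ _ _ hp' hq' hr' ?_
  refine inj _ (AlgebraicClosure (FractionRing (MvPolynomial R ℤ)))
    ((algebraMap (FractionRing (MvPolynomial R ℤ)) _).comp (algebraMap _ _)) ?_ _ _ _
    hp' hq' hr' (closed _ inferInstance _ _ _ (by simp [hp']) (by simp [hq']) (by simp [hr']))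
  exact (algebraMap (FractionRing (MvPolynomial R ℤ)) _).injective.comp (IsFractionRing.injective _ _)

/-- Over an algebraically closed field, every polynomial with constant coefficient `1` is a product
of factors `1 - a t`. -/
lemma split_induction {K : Type*} [Field K] [IsAlgClosed K] {Q : ∀ p : K[X], p.coeff 0 = 1 → Prop}
    (one : Q 1 coeff_one_zero)
    (step : ∀ (a : K) (p : K[X]) (hp : p.coeff 0 = 1), Q p hp →
      Q ((1 - C a * X) * p) (by simp [hp]))
    (p : K[X]) (hp : p.coeff 0 = 1) : Q p hp := by
  induction hn : p.natDegree generalizing p with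
  | zero =>
    obtain rfl : p = 1 := by rw [eq_C_of_natDegree_eq_zero hn, hp, C_1]
    exact one
  | succ n ih =>
    obtain ⟨z, hz⟩ := IsAlgClosed.exists_root p (by
      intro h; rw [natDegree_eq_of_degree_eq_some (n := 0) h] at hn; omega)
    have hz0 : z ≠ 0 := by
      rintro rfl
      rw [IsRoot, ← coeff_zero_eq_eval_zero, hp] at hz
      exact one_ne_zero hz
    obtain ⟨s, rfl⟩ := dvd_iff_isRoot.mpr hz
    have e : (X - C z) * s = (1 - C z⁻¹ * X) * (C (-z) * s) := by
      have : C z⁻¹ * C z = (1 : K[X]) := by rw [← C_mul, inv_mul_cancel₀ hz0, C_1]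
      rw [C_neg]
      linear_combination (- X * s) * this
    have h0 : (C (-z) * s).coeff 0 = 1 := by
      rw [← hp, mul_coeff_zero, mul_coeff_zero]; simp
    simp only [e]
    refine step _ _ h0 (ih _ h0 ?_)
    have hs : s ≠ 0 := by rintro rfl; simp at hn
    rw [natDegree_mul (X_sub_C_ne_zero z) hs, natDegree_X_sub_C] at hn
    rw [natDegree_C_mul (neg_ne_zero.mpr hz0)]
    omega

lemma lin_coeff_zero {R : Type*} [CommRing R] (a : R) : (1 - C a * X : R[X]).coeff 0 = 1 := by simp

lemma wmul_one_left {R : Type*} [CommRing R] (q : R[X]) : wmul 1 q = 1 := rootProd_one _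

lemma wmul_linear_linear {R : Type*} [CommRing R] (a b : R) :
    wmul (1 - C a * X) (1 - C b * X) = 1 - C (a * b) * X := by
  rw [wmul_linear _ _ (lin_coeff_zero b)]
  simp only [sub_comp, one_comp, mul_comp, C_comp, X_comp, C_mul]
  ring

lemma wmul_one_right {R : Type*} [CommRing R] (p : R[X]) (hp : p.coeff 0 = 1) : wmul p 1 = 1 := by
  rw [wmul]
  simp only [Polynomial.map_one, one_comp]
  rw [rootProd, resultant_one_right, coeff_map, reverse, coeff_reflect, revAt_le le_rfl,
    Nat.sub_self, hp]
  simp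

lemma wmul_comm {R : Type*} [CommRing R] (p q : R[X]) (hp : p.coeff 0 = 1) (hq : q.coeff 0 = 1) :
    wmul p q = wmul q p := by
  refine exists_split p q 1 hp hq (by simp) (fun {S} _ p q _ ↦ wmul p q = wmul q p) ?_ ?_ ?_
  · intro K _ _ p q _ hp hq _
    induction p, hp using split_induction with
    | one => rw [wmul_one_left, wmul_one_right q hq]
    | step a p hp ih =>
      rw [wmul_mul_left _ _ _ (lin_coeff_zero a) hp hq, wmul_mul_right _ _ _ hq (lin_coeff_zero a) hp,
        ih]
      refine congrArg (· * _) ?_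
      clear ih
      induction q, hq using split_induction with
      | one => rw [wmul_one_left, wmul_one_right _ (lin_coeff_zero a)]
      | step b q hq ih =>
        rw [wmul_mul_left _ _ _ (lin_coeff_zero b) hq (lin_coeff_zero a),
          wmul_mul_right _ _ _ (lin_coeff_zero a) (lin_coeff_zero b) hq, ih, wmul_linear_linear,
          wmul_linear_linear, mul_comm a b]
  · intro S T _ _ f hf p q r hp hq hr h
    rw [wmul_map f _ _ hp hq, wmul_map f _ _ hq hp] at h
    exact map_injective f hf h
  · intro S T _ _ f p q r hp hq hr h
    rw [wmul_map f _ _ hp hq, wmul_map f _ _ hq hp, h]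

lemma wmul_assoc {R : Type*} [CommRing R] (p q r : R[X]) (hp : p.coeff 0 = 1) (hq : q.coeff 0 = 1)
    (hr : r.coeff 0 = 1) : wmul (wmul p q) r = wmul p (wmul q r) := by
  refine exists_split p q r hp hq hr
    (fun {S} _ p q r ↦ wmul (wmul p q) r = wmul p (wmul q r)) ?_ ?_ ?_
  · intro K _ _ p q r hp hq hr
    have lin := @lin_coeff_zero K _
    induction p, hp using split_induction with
    | one => simp only [wmul_one_left]
    | step a p hp ih =>
      rw [wmul_mul_left _ _ _ (lin a) hp hq, wmul_mul_left _ _ _ (wmul_coeff_zero _ _ (lin a) hq)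
        (wmul_coeff_zero _ _ hp hq) hr, ih, wmul_mul_left _ _ _ (lin a) hp
        (wmul_coeff_zero _ _ hq hr)]
      refine congrArg (· * _) ?_
      clear ih
      induction q, hq using split_induction with
      | one => simp only [wmul_one_left, wmul_one_right _ (lin a)]
      | step b q hq ih =>
        rw [wmul_mul_right _ _ _ (lin a) (lin b) hq, wmul_linear_linear,
          wmul_mul_left _ _ _ (lin _) (wmul_coeff_zero _ _ (lin a) hq) hr, ih,
          wmul_mul_left _ _ _ (lin b) hq hr, wmul_mul_right _ _ _ (lin a)
          (wmul_coeff_zero _ _ (lin b) hr) (wmul_coeff_zero _ _ hq hr)]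
        refine congrArg (· * _) ?_
        rw [wmul_linear _ _ hr, wmul_linear _ _ hr,
          wmul_linear _ _ (by rw [← wmul_linear _ _ hr]; exact wmul_coeff_zero _ _ (lin b) hr),
          comp_assoc]
        simp only [mul_comp, C_comp, X_comp, C_mul]
        rw [mul_assoc, mul_left_comm]
  · intro S T _ _ f hf p q r hp hq hr h
    rw [wmul_map f _ _ hp hq, wmul_map f _ _ hq hr, wmul_map f _ _ hp (wmul_coeff_zero _ _ hq hr),
      wmul_map f _ _ (wmul_coeff_zero _ _ hp hq) hr] at h
    exact map_injective f hf h
  · intro S T _ _ f p q r hp hq hr h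
    rw [wmul_map f _ _ hp hq, wmul_map f _ _ hq hr, wmul_map f _ _ hp (wmul_coeff_zero _ _ hq hr),
      wmul_map f _ _ (wmul_coeff_zero _ _ hp hq) hr, h]

lemma wfrob_one {R : Type*} [CommRing R] (n : ℕ+) : wfrob n (1 : R[X]) = 1 := rootProd_one _

lemma wfrob_wmul {R : Type*} [CommRing R] (n : ℕ+) (p q : R[X]) (hp : p.coeff 0 = 1)
    (hq : q.coeff 0 = 1) : wfrob n (wmul p q) = wmul (wfrob n p) (wfrob n q) := by
  refine exists_split p q 1 hp hq (by simp)
    (fun {S} _ p q _ ↦ wfrob n (wmul p q) = wmul (wfrob n p) (wfrob n q)) ?_ ?_ ?_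
  · intro K _ _ p q _ hp hq _
    have lin := @lin_coeff_zero K _
    induction p, hp using split_induction with
    | one => simp only [wmul_one_left, wfrob_one]
    | step a p hp ih =>
      rw [wmul_mul_left _ _ _ (lin a) hp hq, wfrob_mul n _ _ (wmul_coeff_zero _ _ (lin a) hq)
        (wmul_coeff_zero _ _ hp hq), ih, wfrob_mul n _ _ (lin a) hp,
        wmul_mul_left _ _ _ (wfrob_coeff_zero n _ (lin a)) (wfrob_coeff_zero n _ hp)
        (wfrob_coeff_zero n _ hq)]
      refine congrArg (· * _) ?_
      clear ih
      induction q, hq using split_induction with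
      | one => rw [wfrob_one, wmul_one_right _ (lin a), wfrob_linear, wmul_one_right _ (lin _),
          wfrob_one]
      | step b q hq ih =>
        rw [wmul_mul_right _ _ _ (lin a) (lin b) hq, wfrob_mul n _ _
          (wmul_coeff_zero _ _ (lin a) (lin b)) (wmul_coeff_zero _ _ (lin a) hq), ih,
          wfrob_mul n _ _ (lin b) hq, wmul_mul_right _ _ _ (wfrob_coeff_zero n _ (lin a))
          (wfrob_coeff_zero n _ (lin b)) (wfrob_coeff_zero n _ hq), wmul_linear_linear,
          wfrob_linear, wfrob_linear, wfrob_linear, wmul_linear_linear, mul_pow]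
  · intro S T _ _ f hf p q r hp hq hr h
    rw [wmul_map f _ _ hp hq, wfrob_map f n _ hp, wfrob_map f n _ hq,
      wfrob_map f n _ (wmul_coeff_zero _ _ hp hq),
      wmul_map f _ _ (wfrob_coeff_zero n _ hp) (wfrob_coeff_zero n _ hq)] at h
    exact map_injective f hf h
  · intro S T _ _ f p q r hp hq hr h
    rw [wmul_map f _ _ hp hq, wfrob_map f n _ hp, wfrob_map f n _ hq,
      wfrob_map f n _ (wmul_coeff_zero _ _ hp hq),
      wmul_map f _ _ (wfrob_coeff_zero n _ hp) (wfrob_coeff_zero n _ hq), h]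

lemma wfrob_wfrob {R : Type*} [CommRing R] (m n : ℕ+) (p : R[X]) (hp : p.coeff 0 = 1) :
    wfrob m (wfrob n p) = wfrob (m * n) p := by
  refine exists_split p 1 1 hp (by simp) (by simp)
    (fun {S} _ p _ _ ↦ wfrob m (wfrob n p) = wfrob (m * n) p) ?_ ?_ ?_
  · intro K _ _ p _ _ hp _ _
    have lin := @lin_coeff_zero K _
    induction p, hp using split_induction with
    | one => simp only [wfrob_one]
    | step a p hp ih =>
      rw [wfrob_mul _ _ _ (lin a) hp, wfrob_mul _ _ _ (lin a) hp, wfrob_mul _ _ _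
        (wfrob_coeff_zero n _ (lin a)) (wfrob_coeff_zero n _ hp), ih, wfrob_linear, wfrob_linear,
        wfrob_linear, ← pow_mul, PNat.mul_coe, mul_comm (n : ℕ)]
  · intro S T _ _ f hf p q r hp _ _ h
    rw [wfrob_map f n _ hp, wfrob_map f m _ (wfrob_coeff_zero n _ hp), wfrob_map f _ _ hp] at h
    exact map_injective f hf h
  · intro S T _ _ f p q r hp _ _ h
    rw [wfrob_map f n _ hp, wfrob_map f m _ (wfrob_coeff_zero n _ hp), wfrob_map f _ _ hp, h]


/-- The monoid of polynomials with constant coefficient `1`. -/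
def onePoly (R : Type*) [CommRing R] : Submonoid R[X] where
  carrier := {p | p.coeff 0 = 1}
  mul_mem' {p q} hp hq := by
    change (p * q).coeff 0 = 1
    rw [mul_coeff_zero, show p.coeff 0 = 1 from hp, show q.coeff 0 = 1 from hq, mul_one]
  one_mem' := coeff_one_zero

end RatWitt

open RatWitt

/-- The ring `W_rat(R)` of rational Witt vectors: the group of fractions `P(t) / Q(t)` of polynomials
with `P(0) = Q(0) = 1`. Addition is the product of fractions; multiplication is the biadditive
extension of `⊙`. -/
def WRat (R : Type*) [CommRing R] : Type _ := Algebra.GrothendieckAddGroup (Additive (onePoly R))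

namespace WRat

noncomputable instance (R : Type*) [CommRing R] : AddCommGroup (WRat R) :=
  inferInstanceAs (AddCommGroup (Algebra.GrothendieckAddGroup (Additive (onePoly R))))

/-- The class of a polynomial with constant coefficient `1`. -/
noncomputable def of {R : Type*} [CommRing R] : Additive (onePoly R) →+ WRat R :=
  Algebra.GrothendieckAddGroup.of

/-- Additive maps out of `W_rat(R)` are determined by, and may be prescribed on, polynomials. -/
noncomputable def lift {R A : Type*} [CommRing R] [AddCommGroup A] :
    (Additive (onePoly R) →+ A) ≃ (WRat R →+ A) :=
  Algebra.GrothendieckAddGroup.lift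

lemma lift_of {R A : Type*} [CommRing R] [AddCommGroup A] (f : Additive (onePoly R) →+ A)
    (p : Additive (onePoly R)) : lift f (of p) = f p :=
  DFunLike.congr_fun (Algebra.GrothendieckAddGroup.lift.symm_apply_apply f) p

lemma hom_ext {R A : Type*} [CommRing R] [AddCommGroup A] {f g : WRat R →+ A}
    (h : ∀ p, f (of p) = g (of p)) : f = g :=
  lift.symm.injective (AddMonoidHom.ext h)

/-- The product `⊙` on polynomials with constant coefficient `1`, as a biadditive map. -/
noncomputable def mulPoly (R : Type*) [CommRing R] :
    Additive (onePoly R) →+ Additive (onePoly R) →+ Additive (onePoly R) where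
  toFun p :=
    { toFun := fun q ↦ .ofMul ⟨wmul p.toMul.1 q.toMul.1, wmul_coeff_zero _ _ p.toMul.2 q.toMul.2⟩
      map_zero' := congrArg Additive.ofMul (Subtype.ext (wmul_one_right _ p.toMul.2))
      map_add' := fun q r ↦ congrArg Additive.ofMul
        (Subtype.ext (wmul_mul_right _ _ _ p.toMul.2 q.toMul.2 r.toMul.2)) }
  map_zero' := AddMonoidHom.ext fun _ ↦ congrArg Additive.ofMul (Subtype.ext (wmul_one_left _))
  map_add' p q := AddMonoidHom.ext fun r ↦ congrArg Additive.ofMul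
    (Subtype.ext (wmul_mul_left _ _ _ p.toMul.2 q.toMul.2 r.toMul.2))

lemma mulPoly_comm {R : Type*} [CommRing R] (p q : Additive (onePoly R)) :
    mulPoly R p q = mulPoly R q p :=
  congrArg Additive.ofMul (Subtype.ext (wmul_comm _ _ p.toMul.2 q.toMul.2))

lemma mulPoly_assoc {R : Type*} [CommRing R] (p q r : Additive (onePoly R)) :
    mulPoly R (mulPoly R p q) r = mulPoly R p (mulPoly R q r) :=
  congrArg Additive.ofMul (Subtype.ext (wmul_assoc _ _ _ p.toMul.2 q.toMul.2 r.toMul.2))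

/-- The class of `1 - a t`, as an element of the additive monoid of polynomials. -/
noncomputable def linPoly {R : Type*} [CommRing R] (a : R) : Additive (onePoly R) :=
  .ofMul ⟨1 - C a * X, lin_coeff_zero a⟩

lemma mulPoly_one {R : Type*} [CommRing R] (p : Additive (onePoly R)) :
    mulPoly R (linPoly 1) p = p :=
  congrArg Additive.ofMul (Subtype.ext (by
    change wmul (1 - C 1 * X) p.toMul.1 = p.toMul.1
    rw [wmul_linear _ _ p.toMul.2]; simp))

/-- The multiplication of `W_rat(R)`, as a biadditive map. -/
noncomputable def mulHom (R : Type*) [CommRing R] : WRat R →+ WRat R →+ WRat R :=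
  lift
    { toFun := fun p ↦ lift (of.comp (mulPoly R p))
      map_zero' := hom_ext fun q ↦ by simp [lift_of]
      map_add' := fun p q ↦ hom_ext fun r ↦ by simp [lift_of] }

lemma mulHom_of {R : Type*} [CommRing R] (p q : Additive (onePoly R)) :
    mulHom R (of p) (of q) = of (mulPoly R p q) := by
  rw [mulHom, lift_of]
  exact lift_of _ q

lemma mulHom_comm {R : Type*} [CommRing R] (x y : WRat R) : mulHom R x y = mulHom R y x := by
  have : mulHom R = (mulHom R).flip := hom_ext fun p ↦ hom_ext fun q ↦ by
    rw [AddMonoidHom.flip_apply, mulHom_of, mulHom_of, mulPoly_comm]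
  exact DFunLike.congr_fun (DFunLike.congr_fun this x) y

lemma mulHom_assoc {R : Type*} [CommRing R] (x y z : WRat R) :
    mulHom R (mulHom R x y) z = mulHom R x (mulHom R y z) := by
  have h1 : ((mulHom R).flip z).comp ((mulHom R).flip y) = (mulHom R).flip (mulHom R y z) := by
    refine hom_ext fun p ↦ ?_
    have h2 : ((mulHom R).flip z).comp (mulHom R (of p)) =
        (mulHom R (of p)).comp ((mulHom R).flip z) := by
      refine hom_ext fun q ↦ ?_
      have h3 : mulHom R (mulHom R (of p) (of q)) =
          (mulHom R (of p)).comp (mulHom R (of q)) := by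
        refine hom_ext fun r ↦ ?_
        simp only [AddMonoidHom.comp_apply, mulHom_of, mulPoly_assoc]
      exact DFunLike.congr_fun h3 z
    exact DFunLike.congr_fun h2 y
  exact DFunLike.congr_fun h1 x

lemma mulHom_one {R : Type*} [CommRing R] (x : WRat R) : mulHom R (of (linPoly 1)) x = x := by
  have : mulHom R (of (linPoly 1)) = AddMonoidHom.id _ := hom_ext fun p ↦ by
    rw [mulHom_of, mulPoly_one, AddMonoidHom.id_apply]
  exact DFunLike.congr_fun this x

noncomputable instance (R : Type*) [CommRing R] : CommRing (WRat R) :=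
  { (inferInstance : AddCommGroup (WRat R)) with
    mul := fun x y ↦ mulHom R x y
    one := of (linPoly 1)
    left_distrib := fun x y z ↦ map_add (mulHom R x) y z
    right_distrib := fun x y z ↦ DFunLike.congr_fun (map_add (mulHom R) x y) z
    zero_mul := fun x ↦ DFunLike.congr_fun (map_zero (mulHom R)) x
    mul_zero := fun x ↦ map_zero (mulHom R x)
    mul_assoc := mulHom_assoc
    one_mul := mulHom_one
    mul_one := fun x ↦ (mulHom_comm x _).trans (mulHom_one x)
    mul_comm := mulHom_comm }

lemma of_mul {R : Type*} [CommRing R] (p q : Additive (onePoly R)) :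
    (of p * of q : WRat R) = of (mulPoly R p q) := mulHom_of p q

lemma ringHom_ext {R A : Type*} [CommRing R] [Ring A] {f g : WRat R →+* A}
    (h : ∀ p, f (of p) = g (of p)) : f = g :=
  RingHom.ext fun x ↦ DFunLike.congr_fun (hom_ext (f := (f : WRat R →+ A)) (g := (g : WRat R →+ A)) h) x

/-- The ring homomorphism of rational Witt vectors given by a map of polynomials that respects
products and `⊙`. -/
noncomputable def homOfPoly {R S : Type*} [CommRing R] [CommRing S]
    (g : Additive (onePoly R) →+ Additive (onePoly S)) (one : g (linPoly 1) = linPoly 1)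
    (mul : ∀ p q, g (mulPoly R p q) = mulPoly S (g p) (g q)) : WRat R →+* WRat S :=
  { lift (of.comp g) with
    map_one' := (lift_of (of.comp g) _).trans (congrArg of one)
    map_mul' := by
      intro x y
      have h : (mulHom R).compr₂ (lift (of.comp g)) =
          ((mulHom S).comp (lift (of.comp g))).compl₂ (lift (of.comp g)) :=
        hom_ext fun p ↦ hom_ext fun q ↦ by
          simp only [AddMonoidHom.compr₂_apply, mulHom_of, lift_of, AddMonoidHom.compl₂_apply,
            AddMonoidHom.comp_apply, mul]
      exact DFunLike.congr_fun (DFunLike.congr_fun h x) y }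

lemma homOfPoly_of {R S : Type*} [CommRing R] [CommRing S]
    (g : Additive (onePoly R) →+ Additive (onePoly S)) (one : g (linPoly 1) = linPoly 1)
    (mul : ∀ p q, g (mulPoly R p q) = mulPoly S (g p) (g q)) (p : Additive (onePoly R)) :
    homOfPoly g one mul (of p) = of (g p) := lift_of (of.comp g) p

/-- The Teichmüller map `[a] = 1 - a t`. -/
noncomputable def teich (R : Type*) [CommRing R] : R →* WRat R where
  toFun a := of (linPoly a)
  map_one' := rfl
  map_mul' a b := by
    rw [of_mul]
    exact congrArg of (congrArg Additive.ofMul (Subtype.ext (wmul_linear_linear a b).symm))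

/-- A ring homomorphism applied to the coefficients of a polynomial. -/
noncomputable def mapPoly {R S : Type*} [CommRing R] [CommRing S] (f : R →+* S) :
    Additive (onePoly R) →+ Additive (onePoly S) where
  toFun p := .ofMul ⟨p.toMul.1.map f, by
    change (p.toMul.1.map f).coeff 0 = 1
    rw [coeff_map, show p.toMul.1.coeff 0 = 1 from p.toMul.2, map_one]⟩
  map_zero' := congrArg Additive.ofMul (Subtype.ext (Polynomial.map_one f))
  map_add' _ _ := congrArg Additive.ofMul (Subtype.ext (Polynomial.map_mul f))

lemma mapPoly_lin {R S : Type*} [CommRing R] [CommRing S] (f : R →+* S) (a : R) :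
    mapPoly f (linPoly a) = linPoly (f a) :=
  congrArg Additive.ofMul (Subtype.ext (by
    change (1 - C a * X : R[X]).map f = 1 - C (f a) * X
    simp))

lemma mapPoly_mul {R S : Type*} [CommRing R] [CommRing S] (f : R →+* S)
    (p q : Additive (onePoly R)) : mapPoly f (mulPoly R p q) = mulPoly S (mapPoly f p) (mapPoly f q) :=
  congrArg Additive.ofMul (Subtype.ext (wmul_map f _ _ p.toMul.2 q.toMul.2).symm)

/-- The ring homomorphism `W_rat(R) → W_rat(S)` that applies `f : R → S` to coefficients. -/
noncomputable def mapHom {R S : Type*} [CommRing R] [CommRing S] (f : R →+* S) :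
    WRat R →+* WRat S :=
  homOfPoly (mapPoly f) ((mapPoly_lin f 1).trans (congrArg linPoly (map_one f))) (mapPoly_mul f)

lemma mapHom_of {R S : Type*} [CommRing R] [CommRing S] (f : R →+* S) (p : Additive (onePoly R)) :
    mapHom f (of p) = of (mapPoly f p) := homOfPoly_of _ _ _ _

/-- `F_n` on polynomials. -/
noncomputable def frobPoly {R : Type*} [CommRing R] (n : ℕ+) :
    Additive (onePoly R) →+ Additive (onePoly R) where
  toFun p := .ofMul ⟨wfrob n p.toMul.1, wfrob_coeff_zero n _ p.toMul.2⟩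
  map_zero' := congrArg Additive.ofMul (Subtype.ext (wfrob_one n))
  map_add' p q := congrArg Additive.ofMul (Subtype.ext (wfrob_mul n _ _ p.toMul.2 q.toMul.2))

lemma frobPoly_lin {R : Type*} [CommRing R] (n : ℕ+) (a : R) :
    frobPoly n (linPoly a) = linPoly (a ^ (n : ℕ)) :=
  congrArg Additive.ofMul (Subtype.ext (wfrob_linear n a))

lemma frobPoly_mul {R : Type*} [CommRing R] (n : ℕ+) (p q : Additive (onePoly R)) :
    frobPoly n (mulPoly R p q) = mulPoly R (frobPoly n p) (frobPoly n q) :=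
  congrArg Additive.ofMul (Subtype.ext (wfrob_wmul n _ _ p.toMul.2 q.toMul.2))

/-- The Frobenius endomorphism `F_n` of `W_rat(R)`, with `F_n [a] = [a ^ n]`. -/
noncomputable def frob (R : Type*) [CommRing R] (n : ℕ+) : WRat R →+* WRat R :=
  homOfPoly (frobPoly n) ((frobPoly_lin n 1).trans (congrArg linPoly (one_pow _))) (frobPoly_mul n)

lemma frob_of {R : Type*} [CommRing R] (n : ℕ+) (p : Additive (onePoly R)) :
    frob R n (of p) = of (frobPoly n p) := homOfPoly_of _ _ _ _

lemma frob_teich {R : Type*} [CommRing R] (n : ℕ+) (a : R) :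
    frob R n (teich R a) = teich R (a ^ (n : ℕ)) :=
  (frob_of n _).trans (congrArg of (frobPoly_lin n a))

lemma frob_comp_frob {R : Type*} [CommRing R] (m n : ℕ+) :
    (frob R m).comp (frob R n) = frob R (m * n) := by
  refine ringHom_ext fun p ↦ ?_
  rw [RingHom.comp_apply, frob_of, frob_of, frob_of]
  exact congrArg of (congrArg Additive.ofMul (Subtype.ext (wfrob_wfrob m n _ p.toMul.2)))

lemma mapHom_comp_frob {R S : Type*} [CommRing R] [CommRing S] (f : R →+* S) (n : ℕ+) :
    (mapHom f).comp (frob R n) = (frob S n).comp (mapHom f) := by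
  refine ringHom_ext fun p ↦ ?_
  rw [RingHom.comp_apply, RingHom.comp_apply, frob_of, mapHom_of, mapHom_of, frob_of]
  exact congrArg of (congrArg Additive.ofMul (Subtype.ext (wfrob_map f n _ p.toMul.2).symm))

lemma mapHom_teich {R S : Type*} [CommRing R] [CommRing S] (f : R →+* S) (a : R) :
    mapHom f (teich R a) = teich S (f a) :=
  (mapHom_of f _).trans (congrArg of (mapPoly_lin f a))

end WRat

noncomputable section

open NumberField IsDedekindDomain

/-- The algebraic closure of `ℚ` in `ℂ`. -/
abbrev Qbar : Type := ↥(algebraicClosure ℚ ℂ)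

/-- The maximal abelian extension of `ℚ` in `Qbar`. -/
def maxAbelian : IntermediateField ℚ Qbar := sSup {E | IsAbelianGalois ℚ E}

/-- `ℚ^ab`. -/
abbrev Qab : Type := ↥maxAbelian

instance : Normal ℚ Qab := by
  have e : maxAbelian = ⨆ i : {E : IntermediateField ℚ Qbar | IsAbelianGalois ℚ E}, i.1 :=
    sSup_eq_iSup' _
  have : ∀ i : {E : IntermediateField ℚ Qbar | IsAbelianGalois ℚ E}, Normal ℚ i.1 := fun i ↦ by
    have : IsAbelianGalois ℚ i.1 := i.2
    infer_instance
  have h : Normal ℚ ↥(⨆ i : {E : IntermediateField ℚ Qbar | IsAbelianGalois ℚ E}, i.1) :=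
    IntermediateField.normal_iSup (F := ℚ) (K := Qbar) _ (h := this)
  rwa [← e] at h

/-- The group `ℚ_+` of positive rational numbers. -/
abbrev PosRat : Type := {q : ℚ // 0 < q}

/-- The group `ℝ_+` of positive real numbers. -/
abbrev PosReal : Type := {u : ℝ // 0 < u}

/-- The inclusion `ℚ_+ ⊂ ℝ_+`. -/
def PosRat.toReal (q : PosRat) : PosReal := ⟨(q.1 : ℝ), by exact_mod_cast q.2⟩

/-- The numerator of a positive rational number in lowest terms. -/
def PosRat.num (q : PosRat) : ℕ+ := ⟨q.1.num.toNat, by have := Rat.num_pos.mpr q.2; omega⟩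

/-- The denominator of a positive rational number in lowest terms. -/
def PosRat.den (q : PosRat) : ℕ+ := ⟨q.1.den, q.1.den_pos⟩

/-! ### Deninger's spaces -/

/-- The set of `ℂ`-valued points of the rational Witt space of `Spec 𝓞_K`: pairs `(𝔭, P)` of a
point `𝔭` of `Spec 𝓞_K` and a ring homomorphism `P : W_rat(κ(𝔭)) → ℂ`. -/
structure XDot (K : Type*) [Field K] where
  prime : PrimeSpectrum (𝓞 K)
  hom : WRat prime.asIdeal.ResidueField →+* ℂ

namespace XDot

/-- The map `(𝔓, P) ↦ (f⁻¹ 𝔓, P ∘ W_rat(f))` induced by a homomorphism of fields `f : K → L`. For an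
inclusion it is the natural projection, for `f = σ` in a Galois group it is the right action of
`σ`. -/
def pull {K L : Type*} [Field K] [Field L] (f : K →+* L) (x : XDot L) : XDot K where
  prime := PrimeSpectrum.comap (RingOfIntegers.mapRingHom f) x.prime
  hom := x.hom.comp (WRat.mapHom
    (Ideal.ResidueField.map _ x.prime.asIdeal (RingOfIntegers.mapRingHom f) rfl))

/-- The Frobenius `F_n (𝔭, P) = (𝔭, P ∘ F_n)`. -/
def frob {K : Type*} [Field K] (n : ℕ+) (x : XDot K) : XDot K where
  prime := x.prime
  hom := x.hom.comp (WRat.frob _ n)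

lemma frob_frob {K : Type*} [Field K] (m n : ℕ+) (x : XDot K) :
    frob m (frob n x) = frob (n * m) x := by
  exact congrArg (XDot.mk x.prime) ((RingHom.comp_assoc _ _ _).trans
    (congrArg x.hom.comp (WRat.frob_comp_frob n m)))

lemma pull_frob {K L : Type*} [Field K] [Field L] (f : K →+* L) (n : ℕ+) (x : XDot L) :
    pull f (frob n x) = frob n (pull f x) := by
  exact congrArg (XDot.mk _) ((RingHom.comp_assoc _ _ _).trans
    ((congrArg x.hom.comp (WRat.mapHom_comp_frob _ n).symm).trans (RingHom.comp_assoc _ _ _).symm))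

/-- The multiplicative map `𝓞_K → ℂ`, `a ↦ P([a mod 𝔭])`, of a point `(𝔭, P)`. -/
def mulMap {K : Type*} [Field K] (x : XDot K) : 𝓞 K →* ℂ where
  toFun a := x.hom (WRat.teich _ (algebraMap (𝓞 K) x.prime.asIdeal.ResidueField a))
  map_one' := by simp only [map_one]
  map_mul' a b := by simp only [map_mul]

/-- For `K = Qbar` the points are multiplicative maps `𝓞_K → ℂ`; the topology is that of pointwise
convergence. -/
abbrev pointwiseTopology : TopologicalSpace (XDot Qbar) := .induced (fun x a ↦ x.mulMap a) inferInstance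

/-- The quotient topology with respect to the projection from the space of `Qbar`. -/
instance (K : Type*) [Field K] [Algebra K Qbar] : TopologicalSpace (XDot K) :=
  .coinduced (pull (algebraMap K Qbar)) pointwiseTopology

end XDot

/-- The equivalence relation that defines the inductive limit of copies of `XDot K` indexed by
positive integers ordered by divisibility, with transition maps `F_{m/n}` for `n ∣ m`. -/
def XCheck.setoid (K : Type*) [Field K] : Setoid (Σ _ : ℕ+, XDot K) where
  r x y := ∃ a b : ℕ+, x.1 * a = y.1 * b ∧ x.2.frob a = y.2.frob b
  iseqv :=
    { refl := fun _ ↦ ⟨1, 1, rfl, rfl⟩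
      symm := fun ⟨a, b, h, h'⟩ ↦ ⟨b, a, h.symm, h'.symm⟩
      trans := by
        rintro x y z ⟨a, b, h, h'⟩ ⟨c, d, k, k'⟩
        refine ⟨a * c, d * b, ?_, ?_⟩
        · rw [← mul_assoc, h, ← mul_assoc, ← k, mul_right_comm]
        · rw [← XDot.frob_frob, h', ← XDot.frob_frob, ← k', XDot.frob_frob, XDot.frob_frob,
            mul_comm] }

/-- The inductive limit of the spaces `XDot K` along the Frobenius maps. The class of `(n, x)` is
`F_n⁻¹ x`. -/
def XCheck (K : Type*) [Field K] : Type _ := Quotient (XCheck.setoid K)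

namespace XCheck

instance (K : Type*) [Field K] [Algebra K Qbar] : TopologicalSpace (XCheck K) :=
  inferInstanceAs (TopologicalSpace (Quotient (XCheck.setoid K)))

/-- The class of `(n, x)`. -/
def mk {K : Type*} [Field K] (n : ℕ+) (x : XDot K) : XCheck K := Quotient.mk _ ⟨n, x⟩

/-- The map of inductive limits induced by a homomorphism of fields. -/
def pull {K L : Type*} [Field K] [Field L] (f : K →+* L) : XCheck L → XCheck K :=
  Quotient.map (fun x ↦ ⟨x.1, x.2.pull f⟩) (by
    rintro x y ⟨a, b, h, h'⟩
    exact ⟨a, b, h, by rw [← XDot.pull_frob, h', XDot.pull_frob]⟩)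

/-- The action of `F_q` for `q = a / b` in `ℚ_+`: it sends `F_n⁻¹ x` to `F_{n b}⁻¹ (F_a x)`. -/
def frob {K : Type*} [Field K] (q : PosRat) : XCheck K → XCheck K :=
  Quotient.map (fun x ↦ ⟨x.1 * q.den, x.2.frob q.num⟩) (by
    rintro x y ⟨a, b, h, h'⟩
    refine ⟨a, b, by rw [mul_right_comm, h, mul_right_comm], ?_⟩
    rw [XDot.frob_frob, mul_comm, ← XDot.frob_frob, h', XDot.frob_frob, mul_comm,
      ← XDot.frob_frob])

lemma pull_frob {K L : Type*} [Field K] [Field L] (f : K →+* L) (q : PosRat) (x : XCheck L) :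
    pull f (frob q x) = frob q (pull f x) := by
  induction x using Quotient.inductionOn with
  | h x => exact congrArg (fun z ↦ mk (x.1 * q.den) z) (XDot.pull_frob f _ x.2)

end XCheck

/-- The Deninger system `𝔛_K = XCheck K ×_{ℚ_+} ℝ_+`: the quotient of `XCheck K × ℝ_+` by the action
`(x, u) ↦ (F_q x, q⁻¹ u)` of `ℚ_+`, with the quotient topology. -/
def XFrak (K : Type*) [Field K] : Type _ :=
  Quot fun x y : XCheck K × PosReal ↦ ∃ q : PosRat, y = (x.1.frob q, q.toReal⁻¹ * x.2)

namespace XFrak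

instance (K : Type*) [Field K] [Algebra K Qbar] : TopologicalSpace (XFrak K) :=
  inferInstanceAs (TopologicalSpace (Quot _))

/-- The class `[x, u]`. -/
def mk {K : Type*} [Field K] (x : XCheck K) (u : PosReal) : XFrak K := Quot.mk _ (x, u)

/-- The flow `φ^t [x, u] = [x, t u]`. -/
def flow {K : Type*} [Field K] (t : PosReal) : XFrak K → XFrak K :=
  Quot.map (fun x ↦ (x.1, t * x.2)) (by
    rintro x _ ⟨q, rfl⟩
    exact ⟨q, by rw [mul_left_comm]⟩)

/-- The map of Deninger systems induced by a homomorphism of fields `f : K → L`. -/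
def pull {K L : Type*} [Field K] [Field L] (f : K →+* L) : XFrak L → XFrak K :=
  Quot.map (fun x ↦ (x.1.pull f, x.2)) (by
    rintro x _ ⟨q, rfl⟩
    exact ⟨q, by rw [XCheck.pull_frob]⟩)

/-- The right action of the Galois group, `[(𝔭, P), u]^σ = [(σ⁻¹ 𝔭, P ∘ σ), u]`. -/
def galAct {K : Type*} [Field K] [Algebra ℚ K] (σ : Gal(K/ℚ)) : XFrak K → XFrak K :=
  pull (σ : K →+* K)

/-- The projection `ϖ_{L/K} : 𝔛_L → 𝔛_K`. -/
def proj (K L : Type*) [Field K] [Field L] [Algebra K L] : XFrak L → XFrak K :=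
  pull (algebraMap K L)

end XFrak

/-! ### Roots of unity and the ring of profinite integers -/

/-- The group `μ_∞` of all roots of unity in `ℂ`. -/
abbrev MuInf : Type := ↥(CommGroup.torsion ℂˣ)

/-- The ring `Hom(μ_∞, μ_∞)`: addition is the pointwise product of characters and multiplication is
composition. -/
abbrev HDot : Type := AddMonoid.End (Additive MuInf)

instance instFactPrimes (p : Nat.Primes) : Fact (p : ℕ).Prime := ⟨p.2⟩

/-- The ring of profinite integers `∏_p ℤ_p`. -/
abbrev ZHat : Type := ∀ p : Nat.Primes, ℤ_[p]

lemma exists_primitive (n : ℕ) (hn : n ≠ 0) :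
    ∃ w : MuInf, IsPrimitiveRoot w n ∧ ∀ ζ : MuInf, ζ ^ n = 1 → ∃ i < n, w ^ i = ζ := by
  have : NeZero n := ⟨hn⟩
  have h := Complex.isPrimitiveRoot_exp n hn
  have hu : IsPrimitiveRoot (h.isUnit hn).unit n := h.isUnit_unit hn
  refine ⟨⟨(h.isUnit hn).unit, isOfFinOrder_iff_pow_eq_one.mpr
    ⟨n, Nat.pos_of_ne_zero hn, hu.pow_eq_one⟩⟩, IsPrimitiveRoot.coe_submonoidClass_iff.mp hu, ?_⟩
  intro ζ hζ
  have hζ' : ((ζ.1 : ℂˣ) : ℂ) ^ n = 1 := by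
    rw [← Units.val_pow_eq_pow_val, ← SubgroupClass.coe_pow, hζ]; rfl
  obtain ⟨i, hi, e⟩ := h.eq_pow_of_pow_eq_one hζ'
  exact ⟨i, hi, Subtype.ext (Units.ext (by simpa using e))⟩

lemma pow_val_congr {n : ℕ} {ζ : MuInf} (hζ : ζ ^ n = 1) {k : ZMod n} {l : ℕ}
    (h : k = l) : ζ ^ k.val = ζ ^ l := by
  rw [h, ZMod.val_natCast]
  exact (pow_eq_pow_mod l hζ).symm

lemma exists_expMod (n : ℕ) (hn : n ≠ 0) (χ : HDot) :
    ∃! k : ZMod n, ∀ ζ : MuInf, ζ ^ n = 1 → (χ (.ofMul ζ)).toMul = ζ ^ k.val := by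
  have : NeZero n := ⟨hn⟩
  obtain ⟨w, hw, hgen⟩ := exists_primitive n hn
  have h1 : (χ (.ofMul w)).toMul ^ n = 1 := by
    rw [← toMul_nsmul, ← map_nsmul, ← ofMul_pow, hw.pow_eq_one, ofMul_one, map_zero, toMul_zero]
  obtain ⟨k, hk, e⟩ := hgen _ h1
  refine ⟨(k : ZMod n), fun ζ hζ ↦ ?_, fun l hl ↦ ?_⟩
  · rw [pow_val_congr hζ (l := k) rfl]
    obtain ⟨i, _, rfl⟩ := hgen ζ hζ
    rw [ofMul_pow, map_nsmul, toMul_nsmul, ← e, ← pow_mul, ← pow_mul, mul_comm]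
  · have h2 := hl w hw.pow_eq_one
    rw [← e] at h2
    have h3 := hw.pow_inj hk l.val_lt h2
    rw [h3, ZMod.natCast_zmod_val]

/-- The exponent `k` modulo `n` such that `χ(ζ) = ζ ^ k` for all `n`-th roots of unity `ζ`. -/
def expModFun (n : ℕ) (hn : n ≠ 0) (χ : HDot) : ZMod n := (exists_expMod n hn χ).choose

lemma expModFun_spec (n : ℕ) (hn : n ≠ 0) (χ : HDot) (ζ : MuInf) (hζ : ζ ^ n = 1) :
    (χ (.ofMul ζ)).toMul = ζ ^ (expModFun n hn χ).val :=
  (exists_expMod n hn χ).choose_spec.1 ζ hζ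

lemma expModFun_eq (n : ℕ) (hn : n ≠ 0) (χ : HDot) (l : ℕ)
    (h : ∀ ζ : MuInf, ζ ^ n = 1 → (χ (.ofMul ζ)).toMul = ζ ^ l) : expModFun n hn χ = l :=
  ((exists_expMod n hn χ).choose_spec.2 l fun ζ hζ ↦ by
    rw [pow_val_congr hζ rfl]; exact h ζ hζ).symm

/-- `expModFun` as a ring homomorphism. -/
def expMod (n : ℕ) (hn : n ≠ 0) : HDot →+* ZMod n where
  toFun := expModFun n hn
  map_one' := (expModFun_eq n hn 1 1 fun ζ _ ↦ (pow_one ζ).symm).trans Nat.cast_one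
  map_mul' χ χ' := by
    have : NeZero n := ⟨hn⟩
    refine (expModFun_eq n hn _ ((expModFun n hn χ').val * (expModFun n hn χ).val)
      fun ζ hζ ↦ ?_).trans (by
        rw [Nat.cast_mul, ZMod.natCast_zmod_val, ZMod.natCast_zmod_val, mul_comm])
    change (χ (χ' (.ofMul ζ))).toMul = _
    have e : χ' (.ofMul ζ) = .ofMul (ζ ^ (expModFun n hn χ').val) := expModFun_spec n hn χ' ζ hζ
    rw [e, expModFun_spec n hn χ _ (by rw [← pow_mul, mul_comm, pow_mul, hζ, one_pow]), ← pow_mul]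
  map_zero' := (expModFun_eq n hn 0 0 fun ζ _ ↦ (pow_zero ζ).symm).trans Nat.cast_zero
  map_add' χ χ' := by
    have : NeZero n := ⟨hn⟩
    refine (expModFun_eq n hn _ ((expModFun n hn χ).val + (expModFun n hn χ').val)
      fun ζ hζ ↦ ?_).trans (by
        rw [Nat.cast_add, ZMod.natCast_zmod_val, ZMod.natCast_zmod_val])
    change (χ (.ofMul ζ)).toMul * (χ' (.ofMul ζ)).toMul = _
    rw [expModFun_spec n hn χ ζ hζ, expModFun_spec n hn χ' ζ hζ, pow_add]

lemma expMod_compat (m n : ℕ) (hm : m ≠ 0) (hn : n ≠ 0) (h : m ∣ n) :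
    (ZMod.castHom h (ZMod m)).comp (expMod n hn) = expMod m hm := by
  have : NeZero n := ⟨hn⟩
  refine RingHom.ext fun χ ↦ ?_
  have e := expModFun_eq m hm χ (expModFun n hn χ).val fun ζ hζ ↦ expModFun_spec n hn χ ζ (by
    obtain ⟨c, rfl⟩ := h
    rw [pow_mul, hζ, one_pow])
  refine Eq.trans ?_ e.symm
  change ZMod.castHom h (ZMod m) (expModFun n hn χ) = _
  conv_lhs => rw [← ZMod.natCast_zmod_val (expModFun n hn χ), map_natCast]

/-- The isomorphism `Hom(μ_∞, μ_∞) ≅ ∏_p ℤ_p`, which sends `ζ ↦ ζ ^ a` to `a`. -/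
def HDot.toZHat : HDot →+* ZHat :=
  RingHom.pi fun p ↦
    PadicInt.lift (f := fun k ↦ expMod ((p : ℕ) ^ k) (pow_ne_zero k p.2.ne_zero))
      fun _ _ h ↦ expMod_compat _ _ _ _ (pow_dvd_pow (p : ℕ) h)

/-- If `a` is the image of `χ`, then `χ(ζ) = ζ ^ a` for all roots of unity `ζ` of prime power order
(and these generate `μ_∞`). -/
lemma HDot.apply_eq_pow (χ : HDot) (p : Nat.Primes) (k : ℕ) (ζ : MuInf) (hζ : ζ ^ (p : ℕ) ^ k = 1) :
    (χ (.ofMul ζ)).toMul = ζ ^ (PadicInt.toZModPow k (χ.toZHat p)).val := by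
  have h := RingHom.congr_fun (PadicInt.lift_spec
    (f := fun k ↦ expMod ((p : ℕ) ^ k) (pow_ne_zero k p.2.ne_zero))
    (fun _ _ h ↦ expMod_compat _ _ _ _ (pow_dvd_pow (p : ℕ) h)) k) χ
  refine (expModFun_spec ((p : ℕ) ^ k) (pow_ne_zero k p.2.ne_zero) χ ζ hζ).trans ?_
  exact congrArg (fun z : ZMod ((p : ℕ) ^ k) ↦ ζ ^ z.val) h.symm

/-- A multiplicative map `μ_∞ → ℂ` that sends `1` to `1` has values in `μ_∞`. -/
def HDot.ofHom (φ : MuInf →* ℂ) : HDot :=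
  MonoidHom.toAdditive (φ.toHomUnits.codRestrict (CommGroup.torsion ℂˣ) fun ζ ↦
    MonoidHom.isOfFinOrder φ.toHomUnits (Submonoid.isOfFinOrder_coe.mp ζ.2))

lemma HDot.ofHom_apply (φ : MuInf →* ℂ) (ζ : MuInf) :
    (((HDot.ofHom φ (.ofMul ζ)).toMul : ℂˣ) : ℂ) = φ ζ := rfl

lemma HDot.ext_complex {χ χ' : HDot} (h : ∀ ζ : MuInf,
    (((χ (.ofMul ζ)).toMul : ℂˣ) : ℂ) = (((χ' (.ofMul ζ)).toMul : ℂˣ) : ℂ)) : χ = χ' :=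
  AddMonoidHom.ext fun ζ ↦ Additive.toMul.injective (Subtype.ext (Units.ext (h ζ.toMul)))

/-- The inclusion `ℚ^ab ⊂ ℂ`. -/
def Qab.toComplex : Qab →+* ℂ := (algebraMap Qbar ℂ).comp (algebraMap Qab Qbar)

/-- Every root of unity is an algebraic integer of `ℚ^ab`. -/
lemma exists_intEmb (ζ : MuInf) : ∃ z : 𝓞 Qab, Qab.toComplex z = (ζ.1 : ℂ) := by
  have hfin : IsOfFinOrder (ζ.1 : ℂˣ) := ζ.2
  set n := orderOf (ζ.1 : ℂˣ) with hn
  have hpos : 0 < n := hfin.orderOf_pos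
  have : NeZero n := ⟨hpos.ne'⟩
  have hprim : IsPrimitiveRoot ((ζ.1 : ℂˣ) : ℂ) n :=
    IsPrimitiveRoot.coe_units_iff.mpr (IsPrimitiveRoot.orderOf _)
  have hint : IsIntegral ℤ ((ζ.1 : ℂˣ) : ℂ) := hprim.isIntegral hpos
  have halg : ((ζ.1 : ℂˣ) : ℂ) ∈ algebraicClosure ℚ ℂ :=
    mem_algebraicClosure_iff.mpr hint.tower_top.isAlgebraic
  let z : Qbar := ⟨_, halg⟩
  have hz : IsPrimitiveRoot z n := IsPrimitiveRoot.coe_submonoidClass_iff.mp hprim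
  have : Algebra.IsIntegral ℚ Qbar :=
    (algebraicClosure.isAlgebraic ℚ ℂ).isIntegral
  have hc : IsCyclotomicExtension {n} ℚ (IntermediateField.adjoin ℚ {z}) :=
    hz.intermediateField_adjoin_isCyclotomicExtension ℚ
  have hab : IsAbelianGalois ℚ (IntermediateField.adjoin ℚ {z}) :=
    @IsCyclotomicExtension.isAbelianGalois {n} ℚ _ _ _ _ hc
  have hmem : z ∈ maxAbelian :=
    (le_sSup (a := IntermediateField.adjoin ℚ {z}) hab : _ ≤ maxAbelian)
      (IntermediateField.mem_adjoin_simple_self ℚ z)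
  have hz' : IsPrimitiveRoot (⟨z, hmem⟩ : Qab) n := IsPrimitiveRoot.coe_submonoidClass_iff.mp hz
  exact ⟨⟨⟨z, hmem⟩, hz'.isIntegral hpos⟩, rfl⟩

lemma intEmb_injective : Function.Injective fun z : 𝓞 Qab ↦ Qab.toComplex z :=
  Qab.toComplex.injective.comp RingOfIntegers.coe_injective

/-- The inclusion `μ_∞ ⊂ 𝓞_{ℚ^ab}`. -/
def intEmb : MuInf →* 𝓞 Qab where
  toFun ζ := (exists_intEmb ζ).choose
  map_one' := intEmb_injective (by
    simp only [(exists_intEmb 1).choose_spec, map_one]; rfl)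
  map_mul' ζ ξ := intEmb_injective (by
    simp only [(exists_intEmb (ζ * ξ)).choose_spec, map_mul, (exists_intEmb ζ).choose_spec,
      (exists_intEmb ξ).choose_spec]; rfl)

lemma toComplex_intEmb (ζ : MuInf) : Qab.toComplex (intEmb ζ) = (ζ.1 : ℂ) :=
  (exists_intEmb ζ).choose_spec

/-- The action of `Gal(ℚ^ab/ℚ)` on `μ_∞`. -/
def galChar : Gal(Qab/ℚ) →* HDot where
  toFun σ := HDot.ofHom (((Qab.toComplex.comp (σ : Qab →+* Qab)).comp
    (algebraMap (𝓞 Qab) Qab)).toMonoidHom.comp intEmb)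
  map_one' := HDot.ext_complex fun ζ ↦ toComplex_intEmb ζ
  map_mul' σ τ := HDot.ext_complex fun ζ ↦ by
    let ρ : Gal(Qab/ℚ) → HDot := fun σ ↦ HDot.ofHom (((Qab.toComplex.comp (σ : Qab →+* Qab)).comp
      (algebraMap (𝓞 Qab) Qab)).toMonoidHom.comp intEmb)
    have h : ∀ (σ : Gal(Qab/ℚ)) (ζ : MuInf),
        (((ρ σ (.ofMul ζ)).toMul : ℂˣ) : ℂ) = Qab.toComplex (σ (intEmb ζ : Qab)) := fun _ _ ↦ rfl
    have e : (intEmb (ρ τ (.ofMul ζ)).toMul : Qab) = τ (intEmb ζ : Qab) :=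
      Qab.toComplex.injective ((toComplex_intEmb _).trans (h τ ζ))
    change Qab.toComplex (σ (τ (intEmb ζ : Qab))) = (((ρ σ (ρ τ (.ofMul ζ))).toMul : ℂˣ) : ℂ)
    rw [← e]
    rfl

/-- The cyclotomic character `Gal(ℚ^ab/ℚ) → (∏_p ℤ_p)ˣ`, with `σ(ζ) = ζ ^ cycl(σ)`. -/
def cycl : Gal(Qab/ℚ) →* ZHatˣ :=
  (Units.map (HDot.toZHat : HDot →* ZHat)).comp galChar.toHomUnits

/-! ### Adelic spaces -/

/-- The finite adeles of `ℚ`. -/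
abbrev FinAdele : Type := FiniteAdeleRing (𝓞 ℚ) ℚ

/-- The adeles `𝔸 = 𝔸^f × ℝ` of `ℚ`. -/
abbrev Adele : Type := FinAdele × ℝ

/-- The inclusion `∏_p ℤ_p ⊂ 𝔸^f`, where `ℤ_p` is identified with the integers of the completion of
`ℚ` at `p`. -/
def ZHat.toFinAdele : ZHat →+* FinAdele where
  toFun a := ⟨fun v ↦
      ((Rat.HeightOneSpectrum.adicCompletionIntegers.padicIntEquiv v).symm
        (a (Rat.HeightOneSpectrum.primesEquiv v)) : v.adicCompletionIntegers ℚ),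
    Filter.Eventually.of_forall fun _ ↦ Subtype.property _⟩
  map_one' := FiniteAdeleRing.ext ℚ fun _ ↦ congrArg Subtype.val (map_one _)
  map_mul' _ _ := FiniteAdeleRing.ext ℚ fun _ ↦ congrArg Subtype.val (map_mul _ _ _)
  map_zero' := FiniteAdeleRing.ext ℚ fun _ ↦ congrArg Subtype.val (map_zero _)
  map_add' _ _ := FiniteAdeleRing.ext ℚ fun _ ↦ congrArg Subtype.val (map_add _ _ _)

/-- The adelic space `ℚˣ \ 𝔸 / U`, with the quotient topology. -/
def AdelicSpace (U : Subgroup ZHatˣ) : Type :=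
  Quot fun a b : Adele ↦
    ∃ q : ℚˣ, ∃ u ∈ U, b = algebraMap ℚ Adele q * a * (ZHat.toFinAdele (u : ZHatˣ), 1)

namespace AdelicSpace

instance (U : Subgroup ZHatˣ) : TopologicalSpace (AdelicSpace U) :=
  inferInstanceAs (TopologicalSpace (Quot _))

/-- The class of an adele. -/
def mk {U : Subgroup ZHatˣ} (a : Adele) : AdelicSpace U := Quot.mk _ a

/-- The natural map `ℚˣ \ 𝔸 / U → ℚˣ \ 𝔸 / V` for `U ≤ V`. -/
def proj {U V : Subgroup ZHatˣ} (h : U ≤ V) : AdelicSpace U → AdelicSpace V :=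
  Quot.map id fun _ _ ⟨q, u, hu, e⟩ ↦ ⟨q, u, h hu, e⟩

/-- The action of `ℝ_+` by multiplication on the infinite component. -/
def flow {U : Subgroup ZHatˣ} (t : PosReal) : AdelicSpace U → AdelicSpace U :=
  Quot.map (fun a ↦ a * (1, (t : ℝ))) fun _ _ ⟨q, u, hu, e⟩ ↦
    ⟨q, u, hu, by rw [e]; ring⟩

/-- Multiplication by a unit of `∏_p ℤ_p` on the finite components. -/
def mulUnit {U : Subgroup ZHatˣ} (z : ZHatˣ) : AdelicSpace U → AdelicSpace U :=
  Quot.map (fun a ↦ a * (ZHat.toFinAdele z, 1)) fun _ _ ⟨q, u, hu, e⟩ ↦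
    ⟨q, u, hu, by rw [e]; ring⟩

end AdelicSpace

/-- The adele class space `ℚˣ \ 𝔸`. -/
abbrev AdeleClassSpace : Type := AdelicSpace ⊥

/-- The action of `Gal(ℚ^ab/ℚ)` on the adele class space. -/
def AdeleClassSpace.galAct (σ : Gal(Qab/ℚ)) : AdeleClassSpace → AdeleClassSpace :=
  AdelicSpace.mulUnit (cycl σ)

/-- The adelic space `ℚˣ \ 𝔸 / U_F` of a subextension `F` of `ℚ^ab`, where `U_F` is the subgroup
of `(∏_p ℤ_p)ˣ` corresponding to `Gal(ℚ^ab/F)`. -/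
abbrev CCSpace (F : IntermediateField ℚ Qab) : Type :=
  AdelicSpace (F.fixingSubgroup.map cycl)

namespace CCSpace

/-- The natural covering `φ_{ℚ^ab/F}`. -/
def proj (F : IntermediateField ℚ Qab) : AdeleClassSpace → CCSpace F := AdelicSpace.proj bot_le

/-- The action of `g` in `Gal(F/ℚ)`: multiplication by an extension of `g` to `ℚ^ab`. -/
def galAct {F : IntermediateField ℚ Qab} (g : Gal(F/ℚ)) : CCSpace F → CCSpace F :=
  AdelicSpace.mulUnit (cycl (g.liftNormal Qab))

end CCSpace

/-! ### The map `Ψ` -/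

/-- The character `P|_{μ_∞} ∘ ι_𝔓` of a point `(𝔓, P)`, where `ι_𝔓` is reduction modulo `𝔓`: it
sends `ζ` to `P([ζ mod 𝔓])`. -/
def XDot.char (x : XDot Qab) : HDot := HDot.ofHom (x.mulMap.comp intEmb)

/-- The map `ψ`, with values in `∏_p ℤ_p ≅ Hom(μ_∞, μ_∞)`. -/
def XDot.psi (x : XDot Qab) : ZHat := x.char.toZHat

lemma XDot.mulMap_frob {K : Type*} [Field K] (n : ℕ+) (x : XDot K) (a : 𝓞 K) :
    (x.frob n).mulMap a = x.mulMap a ^ (n : ℕ) := by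
  have h : ∀ b : x.prime.asIdeal.ResidueField,
      x.hom (WRat.frob _ n (WRat.teich _ b)) = x.hom (WRat.teich _ b) ^ (n : ℕ) := fun b ↦ by
    rw [WRat.frob_teich, map_pow, map_pow]
  exact h _

lemma XDot.char_frob (n : ℕ+) (x : XDot Qab) : (x.frob n).char = (n : ℕ) • x.char :=
  HDot.ext_complex fun ζ ↦ x.mulMap_frob n (intEmb ζ)

lemma XDot.psi_frob (n : ℕ+) (x : XDot Qab) : (x.frob n).psi = (n : ℕ) • x.psi := by
  rw [psi, char_frob, map_nsmul]; rfl

lemma XDot.toFinAdele_psi_frob (n : ℕ+) (x : XDot Qab) : ZHat.toFinAdele (x.frob n).psi =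
    algebraMap ℚ FinAdele (n : ℚ) * ZHat.toFinAdele x.psi := by
  have h : algebraMap ℚ FinAdele ((n : ℕ) : ℚ) = ((n : ℕ) : FinAdele) := map_natCast _ _
  rw [psi_frob, map_nsmul, nsmul_eq_mul, ← h]

/-- The extension of `ψ` to the inductive limit, `F_n⁻¹ x ↦ ψ(x) / n`. -/
def XCheck.psi : XCheck Qab → FinAdele :=
  Quotient.lift (fun x ↦ algebraMap ℚ FinAdele ((x.1 : ℚ)⁻¹) * ZHat.toFinAdele x.2.psi) (by
    rintro ⟨n, x⟩ ⟨m, y⟩ ⟨a, b, h, h'⟩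
    dsimp only at h h' ⊢
    have e := congrArg (fun z : XDot Qab ↦ ZHat.toFinAdele z.psi) h'
    simp only [XDot.toFinAdele_psi_frob] at e
    have hq : (n : ℚ) * a = m * b := by exact_mod_cast congrArg PNat.val h
    have ha : (a : ℚ) ≠ 0 := by exact_mod_cast a.ne_zero
    have hb : (b : ℚ) ≠ 0 := by exact_mod_cast b.ne_zero
    have hn : (n : ℚ) ≠ 0 := by exact_mod_cast n.ne_zero
    have hm : (m : ℚ) ≠ 0 := by exact_mod_cast m.ne_zero
    have h1 : (n : ℚ)⁻¹ = ((n : ℚ) * a)⁻¹ * a := by field_simp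
    have h2 : (m : ℚ)⁻¹ = ((n : ℚ) * a)⁻¹ * b := by rw [hq]; field_simp
    rw [h1, h2, map_mul, map_mul, mul_assoc, mul_assoc, e])

lemma XCheck.psi_frob (q : PosRat) (x : XCheck Qab) :
    (x.frob q).psi = algebraMap ℚ FinAdele q.1 * x.psi := by
  induction x using Quotient.inductionOn with
  | h x =>
    change algebraMap ℚ FinAdele (((x.1 * q.den : ℕ+) : ℚ)⁻¹) * ZHat.toFinAdele (x.2.frob q.num).psi =
      algebraMap ℚ FinAdele q.1 * (algebraMap ℚ FinAdele ((x.1 : ℚ)⁻¹) * ZHat.toFinAdele x.2.psi)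
    have hq : q.1 = (q.num : ℚ) / (q.den : ℚ) := by
      have h1 : ((q.num : ℕ) : ℤ) = q.1.num := Int.toNat_of_nonneg (Rat.num_nonneg.mpr q.2.le)
      have h2 : ((q.num : ℕ) : ℚ) = (q.1.num : ℚ) := by exact_mod_cast congrArg (Int.cast (R := ℚ)) h1
      rw [h2]
      exact (Rat.num_div_den q.1).symm
    rw [XDot.toFinAdele_psi_frob, ← mul_assoc, ← mul_assoc, ← map_mul, ← map_mul]
    refine congrArg (fun r : ℚ ↦ algebraMap ℚ FinAdele r * ZHat.toFinAdele x.2.psi) ?_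
    rw [hq, PNat.mul_coe, Nat.cast_mul, mul_inv]
    ring

/-- The space `𝔸^f ×_{ℚ_+} ℝ_+`: the quotient of `𝔸^f × ℝ_+` by the action
`(a, u) ↦ (q a, q⁻¹ u)` of `ℚ_+`. -/
def TwistedAdele : Type :=
  Quot fun x y : FinAdele × PosReal ↦
    ∃ q : PosRat, y = (algebraMap ℚ FinAdele q.1 * x.1, q.toReal⁻¹ * x.2)

/-- The map `𝔛_{ℚ^ab} → 𝔸^f ×_{ℚ_+} ℝ_+`, `[x, u] ↦ [ψ(x), u]`. -/
def XFrak.psi : XFrak Qab → TwistedAdele :=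
  Quot.map (fun x ↦ (x.1.psi, x.2)) (by
    rintro x _ ⟨q, rfl⟩
    exact ⟨q, by rw [XCheck.psi_frob]⟩)

/-- The map `τ : 𝔸^f ×_{ℚ_+} ℝ_+ → ℚˣ \ 𝔸`, `[a, u] ↦ [(a, u⁻¹)]`. -/
def TwistedAdele.tau : TwistedAdele → AdeleClassSpace :=
  Quot.map (fun x ↦ (x.1, ((x.2⁻¹ : PosReal) : ℝ))) (by
    rintro x _ ⟨q, rfl⟩
    refine ⟨Units.mk0 q.1 q.2.ne', 1, Subgroup.one_mem _, ?_⟩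
    refine Prod.ext ?_ ?_
    · simp
    · simp [PosRat.toReal, mul_comm])

/-- The map `Ψ_{ℚ^ab} : 𝔛_{ℚ^ab} → ℚˣ \ 𝔸`. -/
def Psi (x : XFrak Qab) : AdeleClassSpace := x.psi.tau

end

/-! The substance lies in the existence and the continuity of Ψ_F. The projection 𝔛_{ℚ^ab} → 𝔛_F is
surjective. This gives uniqueness and reduces the equivariance of Ψ_F to that of Ψ over ℚ^ab, which
is a computation: ψ(x^σ) = ψ(x)·cycl(σ) (`XDot.psi_pull`), and the coordinate u enters Ψ as u⁻¹.

Existence rests on one claim (`exists_psi_eq`): if two points x, y over ℚ^ab have the same image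
over F, then ψ(y) = ψ(x)·cycl(σ) for some σ in Gal(ℚ^ab/F), and this factor dies in the quotient by
U_F. To see this, let b run through the conjugates over F of an algebraic integer a. The elementary
symmetric functions of the [b] are sums of elements [b_T], where b_T is the product of the
conjugates in a set T. Addition in W_rat is multiplication of polynomials, so such a sum is the
class of ∏_T (1 - b_T t), whose coefficients are symmetric in the b and hence lie in 𝓞_F. Thus ∏ (X
- [b]) is defined over W_rat(𝓞_F), where x and y agree. Both points therefore take the same multiset
of values on the conjugates, and y(a) = x(σ a) for some σ, which may depend on a
(`mulMap_eq_of_pull_eq`). For a primitive n-th root of unity this σ serves all n-th roots of unity,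
and compactness of the Galois group provides one σ for all n (`exists_char_eq`).

The same polynomials show that W_rat of an algebraic closure of k is integral over W_rat(k).
Homomorphisms to ℂ therefore extend (`WRat.exists_extend`), whence the surjectivity of the
projections.

Continuity of ψ: modulo p^k, ψ(x) is determined by the value of x at a primitive p^k-th root of
unity, a continuous function of x with values in a finite set. Continuity of Ψ_F: the projection of
the spaces `XDot` from ℚ^ab to F is a quotient map, and remains one after taking the product with
the locally compact space ℝ_+. -/

namespace RatWitt

/-! ### Symmetric functions of the roots of a polynomial -/

/-- A symmetric function with integral coefficients of the roots of a polynomial over `R` is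
an element of `R`. -/
lemma aeval_roots_mem_range {R S : Type*} [CommRing R] [CommRing S] (φ : R →+* S) {n : ℕ}
    (a : Fin n → S) (f : R[X]) (h : f.map φ = ((Finset.univ.val.map a).map fun b ↦ X - C b).prod)
    (p : MvPolynomial (Fin n) ℤ) (hp : p.IsSymmetric) :
    MvPolynomial.aeval a p ∈ φ.range := by
  -- Fundamental theorem of symmetric polynomials: `p` is a polynomial `q` in the elementary
  -- symmetric ones.
  obtain ⟨q, hq⟩ := (MvPolynomial.esymmAlgHom_fin_bijective ℤ n).2 ⟨p, hp⟩
  have hq' : p = MvPolynomial.aeval (fun i : Fin n ↦ MvPolynomial.esymm (Fin n) ℤ (i + 1)) q := by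
    rw [← MvPolynomial.esymmAlgHom_apply, hq]
  have hi : ∀ i : Fin n, ∃ r : R,
      φ r = MvPolynomial.aeval a (MvPolynomial.esymm (Fin n) ℤ (i + 1)) := by
    intro i
    -- Up to sign, the coefficient of degree `n - (i + 1)` is the elementary symmetric function of
    -- degree `i + 1`; the shift arises because `Fin n` starts at `0`.
    have hk := Multiset.prod_X_sub_C_coeff (Finset.univ.val.map a) (k := n - (i + 1)) (by simp)
    rw [← h, coeff_map] at hk
    have hc : (Finset.univ.val.map a).card - (n - (i + 1)) = i + 1 := by
      simp only [Multiset.card_map, Finset.card_val, Finset.card_univ, Fintype.card_fin]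
      omega
    rw [hc] at hk
    refine ⟨(-1) ^ (i + 1 : ℕ) * f.coeff (n - (i + 1)), ?_⟩
    rw [MvPolynomial.aeval_esymm_eq_multiset_esymm, map_mul, hk, ← mul_assoc, map_pow, map_neg,
      map_one, ← mul_pow]
    simp
  choose r hr using hi
  refine ⟨MvPolynomial.aeval r q, ?_⟩
  rw [hq']
  have e1 := MvPolynomial.comp_aeval_apply r φ.toIntAlgHom q
  have e2 := MvPolynomial.comp_aeval_apply
    (fun i : Fin n ↦ MvPolynomial.esymm (Fin n) ℤ (i + 1)) (MvPolynomial.aeval (R := ℤ) a) q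
  rw [e2]
  refine e1.trans ?_
  congr 2
  funext i
  exact hr i

/-- `∏ (1 - a_T t)` over the products `a_T` of `j` roots of a polynomial over `R` has coefficients
in `R`. -/
lemma prod_powersetCard_mem_lifts {R S : Type*} [CommRing R] [CommRing S] (φ : R →+* S) {n : ℕ}
    (a : Fin n → S) (f : R[X]) (h : f.map φ = ((Finset.univ.val.map a).map fun b ↦ X - C b).prod)
    (j : ℕ) : (∏ T ∈ Finset.univ.powersetCard j, (1 - C (∏ i ∈ T, a i) * X : S[X])) ∈ lifts φ := by
  -- The generic product, with variables for the roots. A permutation of the variables permutes the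
  -- `j`-element subsets, so the coefficients of `Q` are symmetric.
  let Q : (MvPolynomial (Fin n) ℤ)[X] :=
    ∏ T ∈ Finset.univ.powersetCard j, (1 - C (∏ i ∈ T, MvPolynomial.X i) * X)
  have hQ : Q.map (MvPolynomial.aeval (R := ℤ) a : MvPolynomial (Fin n) ℤ →+* S) =
      ∏ T ∈ Finset.univ.powersetCard j, (1 - C (∏ i ∈ T, a i) * X : S[X]) := by
    simp [Q, Polynomial.map_prod]
  have hsymm : ∀ k, (Q.coeff k).IsSymmetric := by
    intro k e
    have : Q.map (MvPolynomial.rename (R := ℤ) e : MvPolynomial (Fin n) ℤ →+* _) = Q := by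
      simp only [Q, Polynomial.map_prod, Polynomial.map_sub, Polynomial.map_one,
        Polynomial.map_mul, map_C, map_X, map_prod, RingHom.coe_coe, MvPolynomial.rename_X]
      refine Finset.prod_nbij' (fun T ↦ T.map e.toEmbedding) (fun T ↦ T.map e.symm.toEmbedding)
        ?_ ?_ ?_ ?_ ?_
      · intro T hT; simpa using hT
      · intro T hT; simpa using hT
      · intro T _; ext; simp
      · intro T _; ext; simp
      · intro T _; simp
    conv_rhs => rw [← this]
    rw [coeff_map]; rfl
  rw [← hQ, lifts_iff_coeff_lifts]
  intro k
  rw [coeff_map]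
  exact aeval_roots_mem_range φ a f h _ (hsymm k)

lemma exists_onePoly_lift {R S : Type*} [CommRing R] [CommRing S] (φ : R →+* S)
    (p : Additive (onePoly S)) (hp : p.toMul.1 ∈ lifts φ) :
    ∃ q : Additive (onePoly R), WRat.mapPoly φ q = p := by
  obtain ⟨r, hr⟩ := (mem_lifts _).mp hp
  have h0 : φ (r.coeff 0) = 1 := by
    rw [← coeff_map, hr]; exact p.toMul.2
  -- The constant term of `r` need not be `1`, but it maps to `1`; the correction is killed by `φ`.
  refine ⟨.ofMul ⟨r - C (r.coeff 0 - 1), ?_⟩, congrArg Additive.ofMul (Subtype.ext ?_)⟩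
  · change (r - C (r.coeff 0 - 1)).coeff 0 = 1
    simp
  · change (r - C (r.coeff 0 - 1)).map φ = p.toMul.1
    simp [h0, hr]

end RatWitt

/-! ### Teichmüller elements of conjugates, and integrality of `W_rat` -/

namespace WRat

lemma of_sum {R ι : Type*} [CommRing R] (s : Finset ι) (b : ι → R) :
    ∑ i ∈ s, teich R (b i) = of (.ofMul ⟨∏ i ∈ s, (1 - C (b i) * X), Submonoid.prod_mem _
      fun i _ ↦ lin_coeff_zero (b i)⟩) := by
  have : ∑ i ∈ s, teich R (b i) = of (∑ i ∈ s, linPoly (b i)) := (map_sum of _ _).symm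
  rw [this]
  refine congrArg of (Additive.toMul.injective (Subtype.ext ?_))
  rw [toMul_sum, Submonoid.coe_finsetProd]
  rfl

/-- Since `teich` is multiplicative, the elementary symmetric function is a sum of Teichmüller
elements of products of `j` roots. By `of_sum` this is the class of a single polynomial, and that
polynomial descends to `R` by symmetry. -/
lemma esymm_teich_mem_range {R S : Type*} [CommRing R] [CommRing S] (φ : R →+* S) {n : ℕ}
    (a : Fin n → S) (f : R[X]) (h : f.map φ = ((Finset.univ.val.map a).map fun b ↦ X - C b).prod)
    (j : ℕ) : (Finset.univ.val.map fun i ↦ teich S (a i)).esymm j ∈ (mapHom φ).range := by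
  rw [Finset.esymm_map_val]
  simp only [← map_prod]
  rw [of_sum]
  obtain ⟨q, hq⟩ := exists_onePoly_lift φ (.ofMul ⟨∏ T ∈ Finset.univ.powersetCard j,
    (1 - C (∏ i ∈ T, a i) * X), Submonoid.prod_mem _ fun _ _ ↦ lin_coeff_zero _⟩)
    (prod_powersetCard_mem_lifts φ a f h j)
  exact ⟨of q, by rw [mapHom_of]; exact congrArg of hq⟩

/-- If a monic polynomial over `R` is `∏ (x - a)` over `S`, then `∏ (x - [a])` comes from a monic
polynomial over `W_rat(R)`. -/
lemma exists_monic_teich {R S : Type*} [CommRing R] [CommRing S] (φ : R →+* S) (s : Multiset S)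
    (f : R[X]) (h : f.map φ = (s.map fun b ↦ X - C b).prod) :
    ∃ g : (WRat R)[X], g.Monic ∧
      g.map (mapHom φ) = (s.map fun b ↦ X - C (teich S b)).prod := by
  obtain ⟨n, a, rfl⟩ : ∃ n, ∃ a : Fin n → S, s = Finset.univ.val.map a := by
    induction s using Quotient.inductionOn with
    | h l => exact ⟨l.length, l.get, by simp⟩
  set p := ((Finset.univ.val.map a).map fun b ↦ X - C (teich S b)).prod with hp
  have hp' : p = ((Finset.univ.val.map fun i ↦ teich S (a i)).map fun b ↦ X - C b).prod := by
    rw [hp, Multiset.map_map, Multiset.map_map]; rfl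
  have hmonic : p.Monic := by
    rw [hp']; exact monic_multiset_prod_of_monic _ _ fun b _ ↦ monic_X_sub_C b
  have hl : p ∈ lifts (mapHom φ) := by
    rw [lifts_iff_coeff_lifts]
    intro k
    change _ ∈ (mapHom φ).range
    -- The degree formula used below requires a nontrivial ring.
    rcases subsingleton_or_nontrivial (WRat S) with _ | _
    · exact ⟨0, Subsingleton.elim _ _⟩
    rcases le_or_gt k (Finset.univ.val.map fun i ↦ teich S (a i)).card with hk | hk
    · rw [hp', Multiset.prod_X_sub_C_coeff _ hk]
      exact Subring.mul_mem _ (Subring.pow_mem _ (Subring.neg_mem _ (Subring.one_mem _)) _)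
        (esymm_teich_mem_range φ a f h _)
    · rw [coeff_eq_zero_of_natDegree_lt]
      · exact Subring.zero_mem _
      · rw [hp']
        exact (natDegree_multiset_prod_X_sub_C_eq_card _).trans_lt hk
  -- A coefficientwise lift need not be monic; a monic one is selected.
  obtain ⟨g, hg, -, hm⟩ := lifts_and_natDegree_eq_and_monic hl hmonic
  exact ⟨g, hm, hg⟩

/-- Two homomorphisms `W_rat(S) → A` that agree on `W_rat(R)` agree on Teichmüller representatives
up to a permutation of the roots of a polynomial over `R`. -/
lemma map_teich_eq {R S A : Type*} [CommRing R] [CommRing S] [CommRing A] [IsDomain A]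
    (φ : R →+* S) (s : Multiset S) (f : R[X]) (h : f.map φ = (s.map fun b ↦ X - C b).prod)
    (P Q : WRat S →+* A) (hPQ : P.comp (mapHom φ) = Q.comp (mapHom φ)) :
    s.map (fun b ↦ P (teich S b)) = s.map fun b ↦ Q (teich S b) := by
  obtain ⟨g, -, hg⟩ := exists_monic_teich φ s f h
  -- The image of `g` in `A[X]` depends only on the restriction of `P` to `WRat R`, and over the
  -- domain `A` it determines its multiset of roots, which are the values `P [b]`.
  have key : ∀ P : WRat S →+* A, g.map (P.comp (mapHom φ)) =
      ((s.map fun b ↦ P (teich S b)).map fun b ↦ X - C b).prod := by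
    intro P
    rw [← Polynomial.map_map, hg, ← coe_mapRingHom, map_multiset_prod, Multiset.map_map,
      Multiset.map_map]
    congr 2
    funext b
    simp
  have e := (key P).symm.trans ((congrArg g.map hPQ).trans (key Q))
  rw [← roots_multiset_prod_X_sub_C (s.map fun b ↦ P (teich S b)), e, roots_multiset_prod_X_sub_C]

lemma exists_add_of_eq {R : Type*} [CommRing R] (x : WRat R) :
    ∃ p q : Additive (onePoly R), x + of q = of p := by
  obtain ⟨y, hy⟩ := (AddLocalization.addMonoidOf (⊤ : AddSubmonoid (Additive (onePoly R)))).surj x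
  exact ⟨y.1, y.2, hy⟩

/-- Over a domain, polynomials with constant term `1` are nonzero and hence cancellable, so their
monoid embeds into its Grothendieck group. -/
lemma of_injective {R : Type*} [CommRing R] [IsDomain R] :
    Function.Injective (of : Additive (onePoly R) →+ WRat R) := by
  have : IsCancelAdd (Additive (onePoly R)) := by
    refine @IsCancelAdd.mk _ _ ⟨fun p q r h ↦ ?_⟩ ⟨fun p q r h ↦ ?_⟩
    all_goals
      have hp : p.toMul.1 ≠ 0 := by
        intro h0
        have h1 : p.toMul.1.coeff 0 = 1 := p.toMul.2
        rw [h0, coeff_zero] at h1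
        exact zero_ne_one h1
      have h' := congrArg (fun z : Additive (onePoly R) ↦ z.toMul.1) h
    · exact Additive.toMul.injective (Subtype.ext (mul_left_cancel₀ hp h'))
    · exact Additive.toMul.injective (Subtype.ext (mul_right_cancel₀ hp h'))
  exact Algebra.GrothendieckAddGroup.of_injective

/-- An element of the kernel is a difference of two polynomials with equal images in `S[X]`, by
`of_injective` over `S`. Injectivity on coefficients makes the polynomials equal. -/
lemma mapHom_injective {R S : Type*} [CommRing R] [CommRing S] [IsDomain S] (f : R →+* S)
    (hf : Function.Injective f) : Function.Injective (mapHom f) := by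
  rw [injective_iff_map_eq_zero]
  intro x hx
  obtain ⟨p, q, h⟩ := exists_add_of_eq x
  have e := congrArg (mapHom f) h
  rw [map_add, hx, zero_add, mapHom_of, mapHom_of] at e
  have e' := congrArg (fun z : Additive (onePoly S) ↦ z.toMul.1) (of_injective e)
  have : q = p := Additive.toMul.injective (Subtype.ext (map_injective f hf e'))
  rwa [this, add_eq_right] at h

lemma mapHom_comp {R S T : Type*} [CommRing R] [CommRing S] [CommRing T] (g : S →+* T)
    (f : R →+* S) : (mapHom g).comp (mapHom f) = mapHom (g.comp f) :=
  ringHom_ext fun p ↦ by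
    rw [RingHom.comp_apply, mapHom_of, mapHom_of, mapHom_of]
    exact congrArg of (congrArg Additive.ofMul (Subtype.ext (Polynomial.map_map _ _ _)))

lemma mapHom_id (R : Type*) [CommRing R] : mapHom (RingHom.id R) = RingHom.id (WRat R) :=
  ringHom_ext fun p ↦ by
    rw [mapHom_of]
    exact congrArg of (congrArg Additive.ofMul (Subtype.ext Polynomial.map_id))

/-- Over an algebraically closed field, `W_rat` is additively generated by Teichmüller
representatives. -/
lemma mem_of_teich_mem {K : Type*} [Field K] [IsAlgClosed K] (M : AddSubgroup (WRat K))
    (h : ∀ a, teich K a ∈ M) (x : WRat K) : x ∈ M := by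
  have hof : ∀ p : K[X], ∀ hp : p.coeff 0 = 1, of (.ofMul ⟨p, hp⟩) ∈ M := by
    intro p hp
    induction p, hp using split_induction with
    | one =>
      have : (of (.ofMul ⟨1, coeff_one_zero⟩) : WRat K) = 0 := map_zero of
      rw [this]; exact M.zero_mem
    | step a p hp ih =>
      have : (of (.ofMul ⟨(1 - C a * X) * p, (onePoly K).mul_mem (lin_coeff_zero a) hp⟩) : WRat K) =
          teich K a + of (.ofMul ⟨p, hp⟩) := map_add of (linPoly a) (.ofMul ⟨p, hp⟩)
      exact this ▸ M.add_mem (h a) ih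
  obtain ⟨p, q, e⟩ := exists_add_of_eq x
  rw [eq_sub_of_add_eq e]
  exact M.sub_mem (hof _ p.toMul.2) (hof _ q.toMul.2)

/-- Integral elements form a subring, so Teichmüller elements suffice. The element `[a]` is a root
of `∏ (X - [b])` over the roots `b` of the minimal polynomial of `a`, and this product descends to a
monic polynomial over `WRat k`. -/
lemma mapHom_isIntegral {k Ω : Type*} [Field k] [Field Ω] [Algebra k Ω] [Algebra.IsAlgebraic k Ω]
    [IsAlgClosed Ω] : (mapHom (algebraMap k Ω)).IsIntegral := by
  let _ : Algebra (WRat k) (WRat Ω) := (mapHom (algebraMap k Ω)).toAlgebra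
  refine mem_of_teich_mem (integralClosure (WRat k) (WRat Ω)).toSubring.toAddSubgroup fun a ↦ ?_
  have hint : IsIntegral k a := Algebra.IsIntegral.isIntegral a
  have hs : (minpoly k a).map (algebraMap k Ω) =
      (((minpoly k a).map (algebraMap k Ω)).roots.map fun b ↦ X - C b).prod :=
    (IsAlgClosed.splits _).eq_prod_roots_of_monic ((minpoly.monic hint).map _)
  obtain ⟨g, hg, hgs⟩ := exists_monic_teich (algebraMap k Ω) _ _ hs
  refine ⟨g, hg, ?_⟩
  rw [← eval_map]
  have ha : a ∈ ((minpoly k a).map (algebraMap k Ω)).roots := by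
    rw [mem_roots ((minpoly.monic hint).map _).ne_zero, IsRoot, eval_map_algebraMap, minpoly.aeval]
  refine (congrArg (eval (teich Ω a)) hgs).trans ?_
  rw [eval_multiset_prod, Multiset.map_map]
  exact Multiset.prod_eq_zero (Multiset.mem_map.mpr ⟨a, ha, by simp⟩)

end WRat

/-! ### Extension of homomorphisms to `ℂ` -/

/-- A homomorphism to an algebraically closed field extends along an injective integral
homomorphism. -/
lemma RingHom.IsIntegral.exists_extend {A B L : Type*} [CommRing A] [CommRing B] [Field L]
    [IsAlgClosed L] {f : A →+* B} (hf : f.IsIntegral) (hinj : Function.Injective f)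
    (P : A →+* L) : ∃ Q : B →+* L, Q.comp f = P := by
  let _ : Algebra A B := f.toAlgebra
  have : Algebra.IsIntegral A B := ⟨hf⟩
  have hker : RingHom.ker (algebraMap A B) ≤ RingHom.ker P := by
    rw [(RingHom.injective_iff_ker_eq_bot (algebraMap A B)).mp hinj]; exact bot_le
  have : (RingHom.ker P).IsPrime := RingHom.ker_isPrime P
  -- Lying over: for a prime `q` above `ker P`, the domain `B ⧸ q` is integral over `A ⧸ ker P`, so
  -- the embedding of the latter into `L` extends.
  obtain ⟨q, -, hq, hqP⟩ := Ideal.exists_ideal_over_prime_of_isIntegral (S := B) (RingHom.ker P) ⊥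
    hker
  have : q.LiesOver (RingHom.ker P) := ⟨hqP.symm⟩
  let _ : Algebra (A ⧸ RingHom.ker P) L := (RingHom.kerLift P).toAlgebra
  have : FaithfulSMul (A ⧸ RingHom.ker P) L :=
    (faithfulSMul_iff_algebraMap_injective _ _).mpr (RingHom.kerLift_injective P)
  have : Algebra.IsIntegral (A ⧸ RingHom.ker P) (B ⧸ q) := .tower_top A
  have : FaithfulSMul (A ⧸ RingHom.ker P) (B ⧸ q) :=
    (faithfulSMul_iff_algebraMap_injective _ _).mpr <|
      (injective_iff_map_eq_zero _).mpr fun x ↦ Quotient.inductionOn' x fun a h ↦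
        Ideal.Quotient.eq_zero_iff_mem.mpr (by
          rw [← hqP]; exact (Ideal.Quotient.eq_zero_iff_mem (I := q)).mp h)
  have : IsDomain (B ⧸ q) := Ideal.Quotient.isDomain q
  have : Module.IsTorsionFree (A ⧸ RingHom.ker P) (B ⧸ q) :=
    .trans_faithfulSMul _ (B ⧸ q) _
  let ψ : B ⧸ q →ₐ[A ⧸ RingHom.ker P] L := IsAlgClosed.lift
  refine ⟨(ψ : B ⧸ q →+* L).comp (Ideal.Quotient.mk q), RingHom.ext fun a ↦ ?_⟩
  exact ψ.commutes (Ideal.Quotient.mk _ a)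

/-- Homomorphisms to `ℂ` extend from `W_rat(k)` to `W_rat(l)` for an algebraic field extension
`l / k`. -/
lemma WRat.exists_extend {k l : Type*} [Field k] [Field l] (f : k →+* l)
    (hf : ∀ x, f.IsIntegralElem x) (P : WRat k →+* ℂ) :
    ∃ Q : WRat l →+* ℂ, Q.comp (WRat.mapHom f) = P := by
  let _ : Algebra k l := f.toAlgebra
  have : Algebra.IsIntegral k l := ⟨hf⟩
  have : Algebra.IsAlgebraic k l := inferInstance
  have : Algebra.IsAlgebraic k (AlgebraicClosure l) := .trans k l _
  -- Integrality was shown for algebraically closed fields, so `P` is extended to the algebraic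
  -- closure of `l` and then restricted to `l`.
  obtain ⟨Q, hQ⟩ := RingHom.IsIntegral.exists_extend
    (WRat.mapHom_isIntegral (k := k) (Ω := AlgebraicClosure l))
    (WRat.mapHom_injective _ (algebraMap k (AlgebraicClosure l)).injective) P
  refine ⟨Q.comp (WRat.mapHom (algebraMap l _)), ?_⟩
  rw [RingHom.comp_assoc, WRat.mapHom_comp, ← hQ]
  rfl

noncomputable section

open NumberField IsDedekindDomain Topology Filter

/-- An integral ring homomorphism induces algebraic extensions of residue fields. -/
lemma RingHom.IsIntegral.residueFieldMap {A B : Type*} [CommRing A] [CommRing B] {f : A →+* B}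
    (hf : f.IsIntegral) (I : Ideal A) [I.IsPrime] (J : Ideal B) [J.IsPrime] (h : I = J.comap f) :
    (Ideal.ResidueField.map I J f h).IsIntegral := by
  let _ : Algebra A B := f.toAlgebra
  have : Algebra.IsIntegral A B := ⟨hf⟩
  have : J.LiesOver I := ⟨h⟩
  let _ := Localization.AtPrime.algebraOfLiesOver I J
  have : Algebra.IsAlgebraic I.ResidueField J.ResidueField := inferInstance
  exact this.isIntegral.1

/-! ### Functoriality and lifting of points -/

namespace XDot

/-- The type of `hom` depends on the prime. Comparing through every map `φ` of residue fields under
`𝓞 K` avoids a transport; once the primes are identified, the identity is such a `φ`. -/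
lemma ext_of_map {K : Type*} [Field K] {x y : XDot K} (h : x.prime = y.prime)
    (hom : ∀ φ : x.prime.asIdeal.ResidueField →+* y.prime.asIdeal.ResidueField,
      φ.comp (algebraMap (𝓞 K) _) = algebraMap (𝓞 K) _ →
        x.hom = y.hom.comp (WRat.mapHom φ)) : x = y := by
  obtain ⟨p, P⟩ := x
  obtain ⟨q, Q⟩ := y
  obtain rfl : p = q := h
  refine congrArg (XDot.mk p) ?_
  have := hom (RingHom.id _) rfl
  rwa [WRat.mapHom_id, RingHom.comp_id] at this

/-- A homomorphism out of a residue field is determined by its values on the ring of integers, and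
there both composites are the reduction of the image of `a`. -/
lemma pull_pull {K L M : Type*} [Field K] [Field L] [Field M] (f : K →+* L) (g : L →+* M)
    (x : XDot M) : pull f (pull g x) = pull (g.comp f) x := by
  refine ext_of_map rfl fun φ hφ ↦ ?_
  refine (RingHom.comp_assoc _ _ _).trans (Eq.trans ?_ (RingHom.comp_assoc _ _ _).symm)
  refine congrArg x.hom.comp ?_
  refine (WRat.mapHom_comp _ _).trans (Eq.trans ?_ (WRat.mapHom_comp _ _).symm)
  refine congrArg WRat.mapHom (Ideal.ResidueField.ringHom_ext (RingHom.ext fun a ↦ ?_))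
  have e := RingHom.congr_fun hφ a
  have l : Ideal.ResidueField.map _ x.prime.asIdeal (RingOfIntegers.mapRingHom g) rfl
      (Ideal.ResidueField.map _ (pull g x).prime.asIdeal (RingOfIntegers.mapRingHom f) rfl
        (algebraMap (𝓞 K) _ a)) =
      algebraMap (𝓞 M) _ (RingOfIntegers.mapRingHom g (RingOfIntegers.mapRingHom f a)) :=
    (congrArg _ (Ideal.ResidueField.map_algebraMap _ _ _ _ a)).trans
      (Ideal.ResidueField.map_algebraMap _ _ _ _ _)
  have r : Ideal.ResidueField.map _ x.prime.asIdeal (RingOfIntegers.mapRingHom (g.comp f)) rfl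
      (φ (algebraMap (𝓞 K) _ a)) =
      algebraMap (𝓞 M) _ (RingOfIntegers.mapRingHom (g.comp f) a) :=
    (congrArg _ e).trans (Ideal.ResidueField.map_algebraMap _ _ _ _ _)
  exact l.trans r.symm

/-- The homomorphism `W_rat(𝓞_K) → ℂ` of a point `(𝔭, P)`. -/
def intHom {K : Type*} [Field K] (x : XDot K) : WRat (𝓞 K) →+* ℂ :=
  x.hom.comp (WRat.mapHom (algebraMap (𝓞 K) x.prime.asIdeal.ResidueField))

lemma intHom_teich {K : Type*} [Field K] (x : XDot K) (a : 𝓞 K) :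
    x.intHom (WRat.teich _ a) = x.mulMap a :=
  congrArg x.hom (WRat.mapHom_teich _ a)

lemma intHom_pull {K L : Type*} [Field K] [Field L] (f : K →+* L) (x : XDot L) :
    (pull f x).intHom = x.intHom.comp (WRat.mapHom (RingOfIntegers.mapRingHom f)) := by
  refine (RingHom.comp_assoc _ _ _).trans (Eq.trans ?_ (RingHom.comp_assoc _ _ _).symm)
  refine congrArg x.hom.comp ?_
  refine (WRat.mapHom_comp _ _).trans (Eq.trans ?_ (WRat.mapHom_comp _ _).symm)
  exact congrArg WRat.mapHom (RingHom.ext fun a ↦ Ideal.ResidueField.map_algebraMap _ _ _ _ a)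

lemma mulMap_pull {K L : Type*} [Field K] [Field L] (f : K →+* L) (x : XDot L) (a : 𝓞 K) :
    (pull f x).mulMap a = x.mulMap (RingOfIntegers.mapRingHom f a) := by
  rw [← intHom_teich, intHom_pull, RingHom.comp_apply, WRat.mapHom_teich, intHom_teich]

/-- Lying over provides a prime of `𝓞 L`; the residue field extension is algebraic, so the
homomorphism extends. No algebraicity of `L` over `K` is needed, because rings of integers are
integral over `ℤ`. -/
lemma pull_surjective {K L : Type*} [Field K] [Field L] (f : K →+* L) :
    Function.Surjective (pull f) := by
  let _ : Algebra K L := f.toAlgebra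
  rintro ⟨p, P⟩
  obtain ⟨Q, hQ⟩ : ∃ Q : PrimeSpectrum (𝓞 L),
      PrimeSpectrum.comap (RingOfIntegers.mapRingHom f) Q = p := by
    obtain ⟨Q, -, hQ, h⟩ := Ideal.exists_ideal_over_prime_of_isIntegral (S := 𝓞 L) p.asIdeal ⊥ (by
      intro a ha
      have ha' : algebraMap (𝓞 K) (𝓞 L) a = 0 := ha
      rw [FaithfulSMul.algebraMap_eq_zero_iff] at ha'
      rw [ha']; exact p.asIdeal.zero_mem)
    exact ⟨⟨Q, hQ⟩, PrimeSpectrum.ext h⟩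
  subst hQ
  have hint : (RingOfIntegers.mapRingHom f).IsIntegral :=
    (RingOfIntegers.extension_algebra_isIntegral K L).1
  obtain ⟨R, hR⟩ := WRat.exists_extend
    (Ideal.ResidueField.map _ Q.asIdeal (RingOfIntegers.mapRingHom f) rfl)
    (hint.residueFieldMap _ _ rfl) P
  exact ⟨⟨Q, R⟩, congrArg (XDot.mk _) hR⟩

lemma char_apply (x : XDot Qab) (ζ : MuInf) :
    (((x.char (.ofMul ζ)).toMul : ℂˣ) : ℂ) = x.mulMap (intEmb ζ) := rfl

end XDot

/-! ### Galois action on characters -/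

lemma intEmb_galChar (σ : Gal(Qab/ℚ)) (ζ : MuInf) :
    intEmb (galChar σ (.ofMul ζ)).toMul =
      RingOfIntegers.mapRingHom (σ : Qab →+* Qab) (intEmb ζ) :=
  intEmb_injective (toComplex_intEmb _)

lemma XDot.char_mul_galChar (σ : Gal(Qab/ℚ)) (x : XDot Qab) (ζ : MuInf) :
    ((((x.char * galChar σ) (.ofMul ζ)).toMul : ℂˣ) : ℂ) =
      x.mulMap (RingOfIntegers.mapRingHom (σ : Qab →+* Qab) (intEmb ζ)) := by
  rw [← intEmb_galChar]
  rfl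

lemma XDot.char_pull (σ : Gal(Qab/ℚ)) (x : XDot Qab) :
    (x.pull (σ : Qab →+* Qab)).char = x.char * galChar σ :=
  HDot.ext_complex fun ζ ↦ by
    rw [XDot.char_mul_galChar, XDot.char_apply, XDot.mulMap_pull]

lemma XDot.psi_pull (σ : Gal(Qab/ℚ)) (x : XDot Qab) :
    (x.pull (σ : Qab →+* Qab)).psi = x.psi * (cycl σ : ZHat) := by
  rw [XDot.psi, XDot.char_pull, map_mul]
  rfl

/-! ### Characters of points in one fibre over `F` -/

/-- An algebraic integer of a normal extension `L` of a number field `F` is a root of a polynomial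
over `𝓞_F` whose roots are its conjugates over `F`. -/
lemma exists_prod_conj {F L : Type*} [Field F] [Field L] [NumberField F] [Algebra F L] [Normal F L]
    (a : 𝓞 L) : ∃ (f : (𝓞 F)[X]) (s : Multiset (𝓞 L)), a ∈ s ∧
      (∀ b ∈ s, ∃ σ : Gal(L/F), σ a = b) ∧
      f.map (RingOfIntegers.mapRingHom (algebraMap F L)) = (s.map fun b ↦ X - C b).prod := by
  have hint : IsIntegral (𝓞 F) a := Algebra.IsIntegral.isIntegral a
  -- As `𝓞 F` is integrally closed, the minimal polynomial over `F` already has coefficients in `𝓞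
  -- F`.
  have hF : minpoly F (a : L) = (minpoly (𝓞 F) a).map (algebraMap (𝓞 F) F) :=
    minpoly.isIntegrallyClosed_eq_field_fractions F L hint
  have hintF : IsIntegral F (a : L) := Normal.isIntegral inferInstance _
  have hroot : ∀ b ∈ ((minpoly F (a : L)).map (algebraMap F L)).roots,
      aeval b (minpoly F (a : L)) = 0 := by
    intro b hb
    rw [← eval_map_algebraMap]
    exact isRoot_of_mem_roots hb
  have hbint : ∀ b ∈ ((minpoly F (a : L)).map (algebraMap F L)).roots, IsIntegral ℤ b := by
    intro b hb
    obtain ⟨σ, rfl⟩ := isConjRoot_iff_exists_algEquiv.mp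
      (show IsConjRoot F b (a : L) from
        (minpoly.eq_of_irreducible_of_monic (minpoly.irreducible hintF) (hroot b hb)
          (minpoly.monic hintF)).symm)
    exact (a.2 : IsIntegral ℤ (a : L)).map (σ.toAlgHom.restrictScalars ℤ)
  -- The roots are conjugates of `a`, hence integral, so the multiset of roots can be formed inside
  -- `𝓞 L`.
  let s : Multiset (𝓞 L) := ((minpoly F (a : L)).map (algebraMap F L)).roots.pmap
    (fun b h ↦ (⟨b, h⟩ : 𝓞 L)) hbint
  have hs : s.map (fun b : 𝓞 L ↦ (b : L)) = ((minpoly F (a : L)).map (algebraMap F L)).roots := by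
    exact (Multiset.map_pmap _ _ _ hbint).trans
      ((Multiset.pmap_eq_map _ id _ hbint).trans (Multiset.map_id _))
  have hmem : ∀ b : 𝓞 L, b ∈ s ↔ (b : L) ∈ ((minpoly F (a : L)).map (algebraMap F L)).roots := by
    intro b
    rw [← hs, Multiset.mem_map]
    exact ⟨fun h ↦ ⟨b, h, rfl⟩, fun ⟨c, hc, e⟩ ↦ RingOfIntegers.coe_injective e ▸ hc⟩
  refine ⟨minpoly (𝓞 F) a, s, ?_, fun b hb ↦ ?_, ?_⟩
  · rw [hmem, mem_roots ((minpoly.monic hintF).map _).ne_zero, IsRoot, eval_map_algebraMap,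
      minpoly.aeval]
  · exact isConjRoot_iff_exists_algEquiv.mp
      (minpoly.eq_of_irreducible_of_monic (minpoly.irreducible hintF) (hroot b ((hmem b).mp hb))
          (minpoly.monic hintF)).symm
  · refine map_injective (algebraMap (𝓞 L) L) RingOfIntegers.coe_injective ?_
    have hsplit : (minpoly F (a : L)).map (algebraMap F L) =
        (((minpoly F (a : L)).map (algebraMap F L)).roots.map fun b ↦ X - C b).prod :=
      (Normal.splits inferInstance (a : L)).eq_prod_roots_of_monic ((minpoly.monic hintF).map _)
    rw [← hs, hF, Polynomial.map_map, Multiset.map_map] at hsplit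
    rw [Polynomial.map_map, ← coe_mapRingHom (f := algebraMap (𝓞 L) L), map_multiset_prod,
      Multiset.map_map]
    refine Eq.trans ?_ (hsplit.trans ?_)
    · rfl
    · refine congrArg Multiset.prod (Multiset.map_congr rfl fun b _ ↦ ?_)
      simp

/-- Both points restrict to the same homomorphism on `WRat (𝓞 F)`, so they take the same multiset of
values on the conjugates of `a`. The automorphism obtained depends on `a`. -/
lemma mulMap_eq_of_pull_eq {F L : Type*} [Field F] [Field L] [NumberField F] [Algebra F L]
    [Normal F L] {x y : XDot L} (h : x.pull (algebraMap F L) = y.pull (algebraMap F L)) (a : 𝓞 L) :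
    ∃ σ : Gal(L/F), y.mulMap a = x.mulMap (RingOfIntegers.mapRingHom (σ : L →+* L) a) := by
  obtain ⟨f, s, ha, hs, hf⟩ := exists_prod_conj (F := F) a
  -- The domain of `intHom` does not depend on the point, so the two homomorphisms can be compared
  -- directly.
  have e := congrArg XDot.intHom h
  rw [XDot.intHom_pull, XDot.intHom_pull] at e
  have e' := WRat.map_teich_eq _ s f hf _ _ e
  simp only [XDot.intHom_teich] at e'
  obtain ⟨b, hb, hb'⟩ := Multiset.mem_map.mp (e'.symm ▸ Multiset.mem_map_of_mem _ ha)
  obtain ⟨σ, hσ⟩ := hs b hb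
  refine ⟨σ, hb'.symm.trans (congrArg x.mulMap ?_)⟩
  exact RingOfIntegers.coe_injective hσ.symm

/-- Points with the same image in the space of `F` have characters that are conjugate under
`Gal(ℚ^ab/F)`. -/
lemma exists_char_eq {F : IntermediateField ℚ Qab} [FiniteDimensional ℚ F] {x y : XDot Qab}
    (h : x.pull (algebraMap F Qab) = y.pull (algebraMap F Qab)) :
    ∃ σ ∈ F.fixingSubgroup, y.char = x.char * galChar σ := by
  have : NumberField F := {}
  have : Normal F Qab := Normal.tower_top_of_normal ℚ F Qab
  have : IsGalois ℚ Qab := {}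
  -- `T n` collects the automorphisms over `F` that work for all `n`-th roots of unity. These sets
  -- are closed, nonempty and directed in a compact group, so they have a common element.
  let T : ℕ+ → Set Gal(Qab/ℚ) := fun n ↦ (F.fixingSubgroup : Set Gal(Qab/ℚ)) ∩
    ⋂ ζ : {ζ : MuInf // ζ ^ (n : ℕ) = 1},
      {σ | y.mulMap (intEmb ζ.1) =
        x.mulMap (RingOfIntegers.mapRingHom (σ : Qab →+* Qab) (intEmb ζ.1))}
  have hclosed : ∀ n, IsClosed (T n) := by
    refine fun n ↦ F.fixingSubgroup_isClosed.inter (isClosed_iInter fun ζ ↦ ?_)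
    rw [← isOpen_compl_iff, isOpen_iff_mem_nhds]
    intro σ hσ
    -- The condition at `ζ` depends only on `σ ζ`, so it is invariant under right multiplication by
    -- the stabilizer of `ζ`, an open subgroup.
    have hst := (stabilizer_isOpen_of_isIntegral (K := ℚ) (intEmb ζ.1 : Qab)).leftCoset σ
    refine Filter.mem_of_superset (hst.mem_nhds ⟨1, Subgroup.one_mem _, mul_one σ⟩) ?_
    rintro _ ⟨τ, hτ, rfl⟩
    have hτ' : τ (intEmb ζ.1 : Qab) = intEmb ζ.1 := hτ
    have : RingOfIntegers.mapRingHom ((σ * τ : Gal(Qab/ℚ)) : Qab →+* Qab) (intEmb ζ.1) =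
        RingOfIntegers.mapRingHom (σ : Qab →+* Qab) (intEmb ζ.1) :=
      RingOfIntegers.coe_injective (congrArg σ hτ')
    intro hc
    exact hσ (Eq.trans hc (congrArg x.mulMap this))
  have hne : ∀ n, (T n).Nonempty := by
    intro n
    -- Both sides are multiplicative in `ζ`, so an automorphism that works for the generator `w`
    -- works for all its powers.
    obtain ⟨w, hw, hgen⟩ := exists_primitive n n.ne_zero
    obtain ⟨σ, hσ⟩ := mulMap_eq_of_pull_eq h (intEmb w)
    refine ⟨(F.fixingSubgroupEquiv.symm σ).1, (F.fixingSubgroupEquiv.symm σ).2, ?_⟩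
    refine Set.mem_iInter.mpr fun ζ ↦ ?_
    obtain ⟨i, -, hi⟩ := hgen ζ.1 ζ.2
    change y.mulMap (intEmb ζ.1) = x.mulMap (RingOfIntegers.mapRingHom (σ : Qab →+* Qab) _)
    rw [← hi, map_pow, map_pow, hσ, map_pow, map_pow]
  have hdir : Directed (· ⊇ ·) T := by
    intro m n
    refine ⟨m * n, ?_, ?_⟩
    · refine Set.inter_subset_inter_right _ fun σ hσ ↦ Set.mem_iInter.mpr fun ζ ↦ ?_
      exact Set.mem_iInter.mp hσ ⟨ζ.1, by rw [PNat.mul_coe, pow_mul, ζ.2, one_pow]⟩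
    · refine Set.inter_subset_inter_right _ fun σ hσ ↦ Set.mem_iInter.mpr fun ζ ↦ ?_
      exact Set.mem_iInter.mp hσ ⟨ζ.1, by rw [PNat.mul_coe, mul_comm, pow_mul, ζ.2, one_pow]⟩
  obtain ⟨σ, hσ⟩ := IsCompact.nonempty_iInter_of_directed_nonempty_isCompact_isClosed T hdir hne
    (fun n ↦ (hclosed n).isCompact) hclosed
  refine ⟨σ, (Set.mem_iInter.mp hσ 1).1, HDot.ext_complex fun ζ ↦ ?_⟩
  obtain ⟨n, hn, hζ⟩ := isOfFinOrder_iff_pow_eq_one.mp ζ.2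
  rw [XDot.char_mul_galChar]
  exact Set.mem_iInter.mp (Set.mem_iInter.mp hσ ⟨n, hn⟩).2 ⟨ζ, Subtype.ext hζ⟩

lemma exists_psi_eq {F : IntermediateField ℚ Qab} [FiniteDimensional ℚ F] {x y : XDot Qab}
    (h : x.pull (algebraMap F Qab) = y.pull (algebraMap F Qab)) :
    ∃ σ ∈ F.fixingSubgroup, y.psi = x.psi * (cycl σ : ZHat) := by
  obtain ⟨σ, hσ, e⟩ := exists_char_eq h
  exact ⟨σ, hσ, by rw [XDot.psi, e, map_mul]; rfl⟩

/-! ### Continuity -/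

namespace XDot

lemma continuous_mulMap {K : Type*} [Field K] [Algebra K Qbar] (a : 𝓞 K) :
    Continuous fun x : XDot K ↦ x.mulMap a := by
  refine continuous_coinduced_dom.mpr ?_
  let _ := pointwiseTopology
  have h : Continuous fun x : XDot Qbar ↦ x.mulMap (RingOfIntegers.mapRingHom (algebraMap K Qbar) a) :=
    (continuous_apply _).comp continuous_induced_dom
  refine h.congr fun x ↦ ?_
  exact (mulMap_pull _ x a).symm

end XDot

/-- A continuous function with values in the `n`-th roots of unity is locally constant. -/
lemma Continuous.eventually_eq_of_pow_eq_one {Y : Type*} [TopologicalSpace Y] {f : Y → ℂ}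
    (hf : Continuous f) {n : ℕ} (hn : 0 < n) (h : ∀ y, f y ^ n = 1) (y₀ : Y) :
    ∀ᶠ y in 𝓝 y₀, f y = f y₀ := by
  -- The other `n`-th roots of unity form a finite, hence closed, set; near `y₀` the function avoids
  -- it.
  have hfin : (((nthRootsFinset n (1 : ℂ)).erase (f y₀) : Finset ℂ) : Set ℂ).Finite :=
    Finset.finite_toSet _
  have hopen : (((nthRootsFinset n (1 : ℂ)).erase (f y₀) : Finset ℂ) : Set ℂ)ᶜ ∈ 𝓝 (f y₀) :=
    hfin.isClosed.isOpen_compl.mem_nhds (by simp)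
  filter_upwards [hf.continuousAt.preimage_mem_nhds hopen] with y hy
  by_contra hne
  exact hy (by
    simp only [Finset.coe_erase, Set.mem_sdiff, Finset.mem_coe, Set.mem_singleton_iff]
    exact ⟨(mem_nthRootsFinset hn (1 : ℂ)).mpr (h y), hne⟩)

lemma expMod_eq_of_apply_eq {n : ℕ} (hn : n ≠ 0) {χ χ' : HDot} {w : MuInf}
    (hgen : ∀ ζ : MuInf, ζ ^ n = 1 → ∃ i < n, w ^ i = ζ) (h : χ (.ofMul w) = χ' (.ofMul w)) :
    expMod n hn χ = expMod n hn χ' := by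
  have : NeZero n := ⟨hn⟩
  refine (expModFun_eq n hn χ (expModFun n hn χ').val fun ζ hζ ↦ ?_).trans
    (ZMod.natCast_zmod_val _)
  rw [← expModFun_spec n hn χ' ζ hζ]
  obtain ⟨i, -, rfl⟩ := hgen ζ hζ
  exact congrArg Additive.toMul
    ((map_nsmul χ i _).trans ((congrArg (i • ·) h).trans (map_nsmul χ' i _).symm))

lemma HDot.toZModPow_toZHat (χ : HDot) (p : Nat.Primes) (k : ℕ) :
    PadicInt.toZModPow k (χ.toZHat p) = expMod ((p : ℕ) ^ k) (pow_ne_zero k p.2.ne_zero) χ :=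
  RingHom.congr_fun (PadicInt.lift_spec
    (f := fun k ↦ expMod ((p : ℕ) ^ k) (pow_ne_zero k p.2.ne_zero))
    (fun _ _ h ↦ expMod_compat _ _ _ _ (pow_dvd_pow (p : ℕ) h)) k) χ

/-- A `p`-adic function that is locally constant modulo all powers of `p` is continuous. -/
lemma PadicInt.continuous_of_eventually_toZModPow_eq {p : ℕ} [Fact p.Prime] {Y : Type*}
    [TopologicalSpace Y] {f : Y → ℤ_[p]}
    (h : ∀ k y₀, ∀ᶠ y in 𝓝 y₀, toZModPow k (f y) = toZModPow k (f y₀)) : Continuous f := by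
  rw [continuous_iff_continuousAt]
  intro y₀
  rw [ContinuousAt, Metric.tendsto_nhds]
  intro ε hε
  obtain ⟨k, hk⟩ := PadicInt.exists_pow_neg_lt p hε
  filter_upwards [h k y₀] with y hy
  rw [dist_eq_norm]
  refine lt_of_le_of_lt ((norm_le_pow_iff_mem_span_pow _ _).mpr ?_) hk
  rw [← ker_toZModPow, RingHom.mem_ker, map_sub, hy, sub_self]

/-- Modulo `p ^ k`, the exponent is determined by the value at a generator `w` of the `p ^ k`-th
roots of unity. That value is a continuous function of the point with values in a finite set, hence
locally constant. -/
lemma XDot.continuous_psi : Continuous (XDot.psi : XDot Qab → ZHat) := by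
  refine continuous_pi fun p ↦ PadicInt.continuous_of_eventually_toZModPow_eq fun k x₀ ↦ ?_
  have hn : (p : ℕ) ^ k ≠ 0 := pow_ne_zero k p.2.ne_zero
  obtain ⟨w, hw, hgen⟩ := exists_primitive _ hn
  have hone : ∀ x : XDot Qab, x.mulMap (intEmb w) ^ (p : ℕ) ^ k = 1 := fun x ↦ by
    rw [← map_pow, ← map_pow, hw.pow_eq_one, map_one, map_one]
  filter_upwards [(continuous_mulMap (intEmb w)).eventually_eq_of_pow_eq_one
    (Nat.pos_of_ne_zero hn) hone x₀] with x hx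
  rw [XDot.psi, XDot.psi, HDot.toZModPow_toZHat, HDot.toZModPow_toZHat]
  exact expMod_eq_of_apply_eq hn hgen
    (Additive.toMul.injective (Subtype.ext (Units.ext hx)))

/-- The map factors as a componentwise continuous map to the product of the local integer rings,
followed by the embedding of this product into the restricted product. -/
lemma ZHat.continuous_toFinAdele : Continuous ZHat.toFinAdele := by
  have h : Continuous fun (a : ZHat) (v : HeightOneSpectrum (𝓞 ℚ)) ↦
      ((Rat.HeightOneSpectrum.adicCompletionIntegers.padicIntEquiv v).symm
        (a (Rat.HeightOneSpectrum.primesEquiv v)) : v.adicCompletionIntegers ℚ) :=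
    continuous_pi fun v ↦
      (Rat.HeightOneSpectrum.adicCompletionIntegers.padicIntEquiv v).symm.continuous.comp
        (continuous_apply _)
  have hs := (RestrictedProduct.isEmbedding_structureMap
    (R := fun v : HeightOneSpectrum (𝓞 ℚ) ↦ v.adicCompletion ℚ)
    (A := fun v ↦ (v.adicCompletionIntegers ℚ : Set (v.adicCompletion ℚ)))
    (𝓕 := cofinite)).continuous.comp h
  exact hs

lemma XCheck.continuous_psi : Continuous XCheck.psi := by
  refine continuous_coinduced_dom.mpr (continuous_sigma fun n ↦ ?_)
  have h : Continuous fun x : XDot Qab ↦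
      algebraMap ℚ FinAdele ((n : ℚ)⁻¹) * ZHat.toFinAdele x.psi :=
    (continuous_const_mul _).comp (ZHat.continuous_toFinAdele.comp XDot.continuous_psi)
  exact h

lemma continuous_Psi : Continuous Psi := by
  refine continuous_coinduced_dom.mpr ?_
  have h : Continuous fun x : XCheck Qab × PosReal ↦ ((x.1.psi, ((x.2⁻¹ : PosReal) : ℝ)) : Adele) := by
    refine (XCheck.continuous_psi.comp continuous_fst).prodMk ?_
    have : Continuous fun x : XCheck Qab × PosReal ↦ ((x.2 : ℝ))⁻¹ :=
      (continuous_subtype_val.comp continuous_snd).inv₀ fun x ↦ x.2.2.ne'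
    exact this
  exact continuous_coinduced_rng.comp h

/-! ### Equivariance and descent to subfields of finite degree -/

lemma Psi_flow (t : PosReal) (x : XFrak Qab) :
    Psi (XFrak.flow t x) = AdelicSpace.flow t⁻¹ (Psi x) := by
  induction x using Quot.inductionOn with
  | h x =>
    refine congrArg AdelicSpace.mk (Prod.ext (mul_one _).symm ?_)
    change (((t * x.2)⁻¹ : PosReal) : ℝ) = ((x.2⁻¹ : PosReal) : ℝ) * ((t⁻¹ : PosReal) : ℝ)
    rw [mul_inv_rev]
    rfl

lemma XCheck.psi_pull (σ : Gal(Qab/ℚ)) (x : XCheck Qab) :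
    (x.pull (σ : Qab →+* Qab)).psi = x.psi * ZHat.toFinAdele (cycl σ) := by
  induction x using Quotient.inductionOn with
  | h x =>
    change algebraMap ℚ FinAdele ((x.1 : ℚ)⁻¹) * ZHat.toFinAdele (x.2.pull (σ : Qab →+* Qab)).psi =
      algebraMap ℚ FinAdele ((x.1 : ℚ)⁻¹) * ZHat.toFinAdele x.2.psi * ZHat.toFinAdele (cycl σ)
    rw [XDot.psi_pull, map_mul, mul_assoc]

lemma Psi_galAct (σ : Gal(Qab/ℚ)) (x : XFrak Qab) :
    Psi (XFrak.galAct σ x) = AdeleClassSpace.galAct σ (Psi x) := by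
  induction x using Quot.inductionOn with
  | h x => exact congrArg AdelicSpace.mk (Prod.ext (XCheck.psi_pull σ x.1) (mul_one _).symm)

lemma XFrak.proj_surjective (K L : Type*) [Field K] [Field L] [Algebra K L] :
    Function.Surjective (XFrak.proj K L) := by
  intro y
  induction y using Quot.inductionOn with
  | h y =>
    obtain ⟨y, u⟩ := y
    induction y using Quotient.inductionOn with
    | h y =>
      obtain ⟨n, y⟩ := y
      obtain ⟨x, rfl⟩ := XDot.pull_surjective (algebraMap K L) y
      exact ⟨XFrak.mk (XCheck.mk n x) u, rfl⟩

lemma XFrak.proj_flow {K L : Type*} [Field K] [Field L] [Algebra K L] (t : PosReal)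
    (x : XFrak L) : XFrak.proj K L (XFrak.flow t x) = XFrak.flow t (XFrak.proj K L x) := by
  induction x using Quot.inductionOn with
  | h x => rfl

lemma XFrak.pull_pull {K L M : Type*} [Field K] [Field L] [Field M] (f : K →+* L) (g : L →+* M)
    (x : XFrak M) : XFrak.pull f (XFrak.pull g x) = XFrak.pull (g.comp f) x := by
  induction x using Quot.inductionOn with
  | h x =>
    obtain ⟨x, u⟩ := x
    induction x using Quotient.inductionOn with
    | h x => exact congrArg (fun z ↦ XFrak.mk (XCheck.mk x.1 z) u) (XDot.pull_pull f g x.2)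

/-- The lift `g.liftNormal Qab` is also the one in the definition of `CCSpace.galAct`, so
equivariance over `F` follows from that over `ℚ^ab` for this single lift. -/
lemma XFrak.proj_galAct {F : IntermediateField ℚ Qab} (g : Gal(F/ℚ)) (x : XFrak Qab) :
    XFrak.proj F Qab (XFrak.galAct (g.liftNormal Qab) x) =
      XFrak.galAct g (XFrak.proj F Qab x) := by
  refine (XFrak.pull_pull _ _ x).trans (Eq.trans ?_ (XFrak.pull_pull _ _ x).symm)
  refine congrArg (fun f ↦ XFrak.pull f x) (RingHom.ext fun a ↦ ?_)
  exact g.liftNormal_commutes Qab a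

lemma CCSpace.proj_galAct {F : IntermediateField ℚ Qab} (g : Gal(F/ℚ)) (a : AdeleClassSpace) :
    CCSpace.proj F (AdeleClassSpace.galAct (g.liftNormal Qab) a) =
      CCSpace.galAct g (CCSpace.proj F a) := by
  induction a using Quot.inductionOn with
  | h a => rfl

lemma CCSpace.proj_flow {F : IntermediateField ℚ Qab} (t : PosReal) (a : AdeleClassSpace) :
    CCSpace.proj F (AdelicSpace.flow t a) = AdelicSpace.flow t (CCSpace.proj F a) := by
  induction a using Quot.inductionOn with
  | h a => rfl

lemma CCSpace.continuous_proj (F : IntermediateField ℚ Qab) : Continuous (CCSpace.proj F) :=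
  continuous_coinduced_dom.mpr continuous_coinduced_rng

lemma AdelicSpace.mk_mul_unit {U : Subgroup ZHatˣ} {z : ZHatˣ} (hz : z ∈ U) (a : Adele) :
    (mk a : AdelicSpace U) = mk (a * (ZHat.toFinAdele z, 1)) :=
  Quot.sound ⟨1, z, hz, by rw [Units.val_one, map_one, one_mul]⟩

/-- This makes Ψ_F well defined: changing the lift to `ℚ^ab` multiplies the finite adele by `cycl σ`
with `σ` fixing `F`, an element of `U_F`. -/
lemma proj_Psi_eq {F : IntermediateField ℚ Qab} [FiniteDimensional ℚ F] {x y : XDot Qab}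
    (h : x.pull (algebraMap F Qab) = y.pull (algebraMap F Qab)) (n : ℕ+) (u : PosReal) :
    CCSpace.proj F (Psi (XFrak.mk (XCheck.mk n x) u)) =
      CCSpace.proj F (Psi (XFrak.mk (XCheck.mk n y) u)) := by
  obtain ⟨σ, hσ, e⟩ := exists_psi_eq h
  have h₁ : ∀ z : XDot Qab, CCSpace.proj F (Psi (XFrak.mk (XCheck.mk n z) u)) = AdelicSpace.mk
      (algebraMap ℚ FinAdele ((n : ℚ)⁻¹) * ZHat.toFinAdele z.psi, ((u⁻¹ : PosReal) : ℝ)) :=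
    fun _ ↦ rfl
  rw [h₁, h₁, e, map_mul, ← mul_assoc, AdelicSpace.mk_mul_unit (Subgroup.mem_map_of_mem _ hσ),
    Prod.mk_mul_mk, mul_one]

/-- The map `Ψ_F`, defined by means of preimages in the space of `ℚ^ab`. -/
def PsiSub (F : IntermediateField ℚ Qab) [FiniteDimensional ℚ F] : XFrak F → CCSpace F :=
  Quot.lift (fun p ↦ Quotient.lift (s := XCheck.setoid F)
      (fun y ↦ CCSpace.proj F (Psi (XFrak.mk (XCheck.mk y.1
        (Function.surjInv (XDot.pull_surjective (algebraMap F Qab)) y.2)) p.2)))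
      (by
        rintro ⟨n, y⟩ ⟨m, z⟩ ⟨a, b, h, h'⟩
        obtain ⟨x, rfl⟩ := XDot.pull_surjective (algebraMap F Qab) y
        obtain ⟨w, rfl⟩ := XDot.pull_surjective (algebraMap F Qab) z
        -- The chosen preimages may be replaced by `x` and `w`.
        refine (proj_Psi_eq (Function.surjInv_eq _ _) _ _).trans
          (Eq.trans ?_ (proj_Psi_eq (Function.surjInv_eq _ _) _ _).symm)
        -- Rewriting F_n⁻¹ x as F_{na}⁻¹ (F_a x) moves both points to the common level `n * a = m *
        -- b`, where `x.frob a` and `w.frob b` have the same image over `F`.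
        have e : ∀ (n a : ℕ+) (x : XDot Qab), XCheck.mk n x = XCheck.mk (n * a) (x.frob a) :=
          fun n a x ↦ Quotient.sound ⟨a, 1, (mul_one _).symm, by rw [XDot.frob_frob, mul_one]⟩
        dsimp only at h h' ⊢
        rw [← XDot.pull_frob, ← XDot.pull_frob] at h'
        rw [e n a, e m b, h]
        exact proj_Psi_eq h' _ _) p.1) (by
    rintro ⟨y, u⟩ _ ⟨q, rfl⟩
    induction y using Quotient.inductionOn with
    | h y =>
      obtain ⟨n, y⟩ := y
      obtain ⟨x, rfl⟩ := XDot.pull_surjective (algebraMap F Qab) y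
      -- Since `pull` commutes with Frobenius, `x.frob q.num` at level `n * q.den` lifts the
      -- translate by `q`. The two lifts then define the same point of 𝔛_{ℚ^ab}.
      refine (proj_Psi_eq (Function.surjInv_eq _ _) n u).trans (Eq.trans ?_
        (proj_Psi_eq (y := x.frob q.num) ((Function.surjInv_eq _ _).trans
          (XDot.pull_frob _ _ _).symm) (n * q.den) (q.toReal⁻¹ * u)).symm)
      exact congrArg (fun z ↦ CCSpace.proj F (Psi z)) (Quot.sound ⟨q, rfl⟩))

lemma PsiSub_proj {F : IntermediateField ℚ Qab} [FiniteDimensional ℚ F] (x : XFrak Qab) :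
    PsiSub F (XFrak.proj F Qab x) = CCSpace.proj F (Psi x) := by
  induction x using Quot.inductionOn with
  | h x =>
    obtain ⟨x, u⟩ := x
    induction x using Quotient.inductionOn with
    | h x => exact proj_Psi_eq (Function.surjInv_eq _ _) _ _

/-- Both topologies are coinduced from the space of `Qbar`, and the projection to `F` factors
through `ℚ^ab`. -/
lemma XDot.isQuotientMap_pull (F : IntermediateField ℚ Qab) :
    IsQuotientMap (XDot.pull (algebraMap F Qab) : XDot Qab → XDot F) where
  eq_coinduced := by
    have h : (XDot.pull (algebraMap F Qbar) : XDot Qbar → XDot F) =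
        XDot.pull (algebraMap F Qab) ∘ XDot.pull (algebraMap Qab Qbar) :=
      funext fun x ↦ (XDot.pull_pull (algebraMap F Qab) (algebraMap Qab Qbar) x).symm
    exact (congrArg (fun f ↦ TopologicalSpace.coinduced f XDot.pointwiseTopology) h).trans
      (@coinduced_compose _ _ _ XDot.pointwiseTopology _ _).symm
  surjective := XDot.pull_surjective _

lemma continuous_PsiSub (F : IntermediateField ℚ Qab) [FiniteDimensional ℚ F] :
    Continuous (PsiSub F) := by
  -- A product of a quotient map with an identity need not be a quotient map; local compactness of
  -- `ℝ_+` ensures it, both for the inductive limit and for the projection from `ℚ^ab`.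
  have : LocallyCompactSpace PosReal := (isOpen_Ioi (a := (0 : ℝ))).locallyCompactSpace
  refine continuous_coinduced_dom.mpr ?_
  have hq : IsQuotientMap (Quotient.mk (XCheck.setoid F)) := isQuotientMap_quot_mk
  refine hq.continuous_lift_prod_left
    ((Homeomorph.sigmaProdDistrib.symm.isQuotientMap.continuous_iff).mpr
      (continuous_sigma fun n ↦ (XDot.isQuotientMap_pull F).continuous_lift_prod_left ?_))
  have h : Continuous fun p : XDot Qab × PosReal ↦
      CCSpace.proj F (Psi (XFrak.mk (XCheck.mk n p.1) p.2)) := by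
    refine (CCSpace.continuous_proj F).comp (continuous_Psi.comp ?_)
    have hm : Continuous fun p : XCheck Qab × PosReal ↦ XFrak.mk p.1 p.2 := continuous_coinduced_rng
    have hc : Continuous (XCheck.mk n : XDot Qab → XCheck Qab) :=
      (continuous_quot_mk (r := (XCheck.setoid Qab).r)).comp continuous_sigmaMk
    exact hm.comp ((hc.comp continuous_fst).prodMk continuous_snd)
  exact h.congr fun p ↦ (PsiSub_proj (XFrak.mk (XCheck.mk n p.1) p.2)).symm

end

theorem lemma3p5 :
    Continuous Psi ∧
    (∀ (t : PosReal) (x : XFrak Qab), Psi (XFrak.flow t x) = AdelicSpace.flow t⁻¹ (Psi x)) ∧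
    (∀ (σ : Gal(Qab/ℚ)) (x : XFrak Qab),
      Psi (XFrak.galAct σ x) = AdeleClassSpace.galAct σ (Psi x)) ∧
    ∀ (F : IntermediateField ℚ Qab) [FiniteDimensional ℚ F],
      ∃ PsiF : XFrak F → CCSpace F,
        (∀ x : XFrak Qab, PsiF (XFrak.proj F Qab x) = CCSpace.proj F (Psi x)) ∧
        (∀ Psi' : XFrak F → CCSpace F,
          (∀ x : XFrak Qab, Psi' (XFrak.proj F Qab x) = CCSpace.proj F (Psi x)) → Psi' = PsiF) ∧
        Continuous PsiF ∧
        (∀ (t : PosReal) (y : XFrak F), PsiF (XFrak.flow t y) = AdelicSpace.flow t⁻¹ (PsiF y)) ∧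
        (∀ (g : Gal(F/ℚ)) (y : XFrak F),
          PsiF (XFrak.galAct g y) = CCSpace.galAct g (PsiF y)) := by
  refine ⟨continuous_Psi, Psi_flow, Psi_galAct, fun F _ ↦ ⟨PsiSub F, PsiSub_proj, ?_,
    continuous_PsiSub F, ?_, ?_⟩⟩
  -- Uniqueness and both equivariances can be checked on images of points over `ℚ^ab`.
  · intro Psi' h
    funext y
    obtain ⟨x, rfl⟩ := XFrak.proj_surjective F Qab y
    rw [h, PsiSub_proj]
  · intro t y
    obtain ⟨x, rfl⟩ := XFrak.proj_surjective F Qab y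
    rw [← XFrak.proj_flow, PsiSub_proj, PsiSub_proj, Psi_flow, CCSpace.proj_flow]
  · intro g y
    obtain ⟨x, rfl⟩ := XFrak.proj_surjective F Qab y
    rw [← XFrak.proj_galAct, PsiSub_proj, PsiSub_proj, Psi_galAct, CCSpace.proj_galAct]
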